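/- **Setting.** Let $k_1,k_2,k_3\in\mathbb R^2$ be the vertices of an equilateral triangle, $l_i(x)=\tfrac12(x+k_i)$, and let $K=\mathrm{SG}$ (the Sierpiński gasket) be the attractor of the iterated function system $\{l_1,l_2,l_3\}$. Put $V_0=\{k_1,k_2,k_3\}$. Fix an integer $n\ge 1$, let $\mathcal N=\{1,2,3\}^n$, $l_i=l_{i_1}\circ\dots\circ l_{i_n}$ for $i=(i_1,\dots,i_n)\in\mathcal N$, and $V=V_n=\bigcup_{i\in\mathcal N}l_i(V_0)$. Let $p:V\to\mathbb R$, and for $i\in\mathcal N$ let $s_i,q_i:K\to\mathbb R$ be continuous with $\|s_i\|_\infty<1$ and $q_i(v)=p(l_i(v))-s_i(v)p(v)$ for all $v\in V_0$. Let $f^*$ be the corresponding fractal interpolation function (FIF), i.e. the continuous function $f^*:K\to\mathbb R$ with $f^*|_V=p$ and $f^*(l_i(x))=s_i(x)f^*(x)+q_i(x)$ for all $x\in K$, $i\in\mathcal N$. Let $G_{f^*}\subset\mathbb R^3$ be its graph. **Notation.** Let $\gamma=\sum_{i\in\mathcal N}\|s_i\|_\infty$. Let $\gamma_{1,0}$ be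 the sum of $|s_i|$ over those $i\in\mathcal N$ for which $s_i$ is constant and $q_i$ is affine; let $\gamma_{2,0}$ (resp. $\gamma_{3,0}$) be the sum of $s_i$ over those $i\in\mathcal N$ for which $s_i$ is a non-negative constant and $q_i$ is concave (resp. convex). Here $q$ is affine if it is the restriction to $K$ of an affine function on $\mathbb R^2$, and concave if $q((1-t)x+ty)\ge(1-t)q(x)+tq(y)$ whenever $t\in[0,1]$ and $x,\,y,\,(1-t)x+ty\in K$; convex means that $-q$ is concave. For $\eta\in[0,\log_{2}3]$, $\mathcal C^\eta(\mathrm{SG})$ is the set of continuous $g:K\to\mathbb R$ with $$\sup_{m\ge1}\ \frac{\sum_{\omega\in\mathcal N^m}\big(\sup_{l_\omega(K)}g-\inf_{l_\omega(K)}g\big)}{2^{nm(\log_{2}3-\eta)}}<\infty,\qquad l_\omega=l_{\omega_1}\circ\dots\circ l_{\omega_m},$$ and $\eta'=\min\{1,\eta\}$. For nonempty bounded $F\subset\mathbb R^d$, $N_\delta(F)$ is the least number of axis-parallel boxes of side length $\delta$ covering $F$; $\underline{\dim}_B F$ and $\overline{\dim}_B F$ are the lower and upper limits of $\log N_\delta(F)/\log(1/\delta)$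 as $\delta\to0^+$, and $\dim_B F$ is their common value when they agree. **Theorem.** Assume that there are $y_1,y_2,y_3\in V$ and $\lambda\in(0,1)$ with $y_3=(1-\lambda)y_1+\lambda y_2$ and $L:=p(y_3)-((1-\lambda)p(y_1)+\lambda p(y_2))\ne0$. 1. If $\gamma_{1,0}\neq0$, then $1+\log_{2^n}\gamma_{1,0}\le\underline{\dim}_B(G_{f^*})$. 2. If $L>0$ and $\gamma_{2,0}\ne0$, then $1+\log_{2^n}\gamma_{2,0}\le\underline{\dim}_B(G_{f^*})$. 3. If $L<0$ and $\gamma_{3,0}\ne0$, then $1+\log_{2^n}\gamma_{3,0}\le\underline{\dim}_B(G_{f^*})$. 4. Suppose that $s_i,q_i\in\mathcal C^\eta(\mathrm{SG})$ for all $i\in\mathcal N$, where $\eta\in[0,\log_23]$, and that either $\gamma_{1,0}=\gamma$, or $L>0$ and $\gamma_{2,0}=\gamma$, or $L<0$ and $\gamma_{3,0}=\gamma$. Then $\dim_B(G_{f^*})$ exists and $$\dim_B(G_{f^*})=\begin{cases}1+\dfrac{\log\gamma}{\log 2^n},&\text{if }\gamma>\left(\dfrac{3}{2^{\eta'}}\right)^n,\\[2mm]\dfrac{\log3}{\log2},&\text{if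 }\gamma\le\left(\dfrac32\right)^n\text{ and }\eta'=1.\end{cases}$$ -/

import Mathlib

open Set Filter Topology TopologicalSpace

noncomputable section

namespace SGFIF

/-! ## Iterated function systems and attractors -/

/-- The Hutchinson operator of the family of maps `f`. -/
def hutchinson {ι X : Type*} (f : ι → X → X) (B : Set X) : Set X :=
  ⋃ i, f i '' B

/-- `A` is the attractor of the iterated function system `f`: it is the unique nonempty compact
fixed point of the Hutchinson operator, and the iterates of that operator on any nonempty compact
set converge to `A` in the Hausdorff distance. -/
structure IsAttractor {ι X : Type*} [MetricSpace X] (f : ι → X → X)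
    (A : NonemptyCompacts X) : Prop where
  fixed : hutchinson f (A : Set X) = A
  unique : ∀ B : NonemptyCompacts X, hutchinson f (B : Set X) = B → B = A
  tendsto : ∀ B : NonemptyCompacts X,
    Tendsto (fun n : ℕ => Metric.hausdorffEDist ((hutchinson f)^[n] (B : Set X)) (A : Set X))
      atTop (𝓝 0)

/-- For a word `ω = (ω 0, …, ω (k-1))`, the composition `f (ω 0) ∘ ⋯ ∘ f (ω (k-1))`. -/
def wordMap {ι X : Type*} (f : ι → X → X) : {k : ℕ} → (Fin k → ι) → X → X
  | 0, _ => id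
  | _ + 1, ω => f (ω 0) ∘ wordMap f (Fin.tail ω)

/-! ## The Sierpiński gasket -/

/-- The Euclidean plane. -/
abbrev Plane : Type := EuclideanSpace ℝ (Fin 2)

/-- `k 0, k 1, k 2` are the vertices of a (nondegenerate) equilateral triangle. -/
def IsEquilateral (k : Fin 3 → Plane) : Prop :=
  ∃ a : ℝ, 0 < a ∧ ∀ i j, i ≠ j → dist (k i) (k j) = a

/-- The contractions `x ↦ (x + k i) / 2`. -/
def sgMap (k : Fin 3 → Plane) (i : Fin 3) (x : Plane) : Plane :=
  (1 / 2 : ℝ) • (x + k i)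

theorem continuous_sgMap (k : Fin 3 → Plane) (i : Fin 3) : Continuous (sgMap k i) := by
  unfold sgMap; fun_prop

/-- The Hutchinson operator of the three maps, acting on nonempty compact sets. -/
def sgHutchinson (k : Fin 3 → Plane) (B : NonemptyCompacts Plane) : NonemptyCompacts Plane :=
  ⟨⟨hutchinson (sgMap k) (B : Set Plane),
    isCompact_iUnion fun i => B.isCompact.image (continuous_sgMap k i)⟩,
    (B.nonempty.image (sgMap k 0)).mono (subset_iUnion (fun i => sgMap k i '' (B : Set Plane)) 0)⟩

theorem coe_sgHutchinson (k : Fin 3 → Plane) (B : NonemptyCompacts Plane) :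
    (sgHutchinson k B : Set Plane) = hutchinson (sgMap k) (B : Set Plane) := rfl

theorem coe_sgHutchinson_iterate (k : Fin 3 → Plane) (B : NonemptyCompacts Plane) (n : ℕ) :
    (((sgHutchinson k)^[n] B : NonemptyCompacts Plane) : Set Plane)
      = (hutchinson (sgMap k))^[n] (B : Set Plane) := by
  induction n with
  | zero => rfl
  | succ n ih => rw [Function.iterate_succ_apply', Function.iterate_succ_apply',
      coe_sgHutchinson, ih]

theorem edist_sgMap (k : Fin 3 → Plane) (i : Fin 3) (x y : Plane) :
    edist (sgMap k i x) (sgMap k i y) = ((1 / 2 : NNReal) : ENNReal) * edist x y := by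
  unfold sgMap
  rw [edist_smul₀, edist_add_right, ENNReal.smul_def, smul_eq_mul]
  congr 2
  ext
  simp

theorem infEDist_image_le {X Y : Type*} [PseudoEMetricSpace X] [PseudoEMetricSpace Y]
    {C : NNReal} {f : X → Y} (hf : ∀ x y, edist (f x) (f y) = (C : ENNReal) * edist x y) (hC : C ≠ 0)
    (x : X) (B : Set X) :
    Metric.infEDist (f x) (f '' B) ≤ C * Metric.infEDist x B := by
  simp only [Metric.infEDist, iInf_image, hf]
  simp only [ENNReal.mul_iInf_of_ne (by exact_mod_cast hC) ENNReal.coe_ne_top]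
  exact le_rfl

theorem contracting_sgHutchinson (k : Fin 3 → Plane) :
    ContractingWith (1 / 2) (sgHutchinson k) := by
  refine ⟨by rw [← NNReal.coe_lt_coe]; norm_num, fun A B => ?_⟩
  change Metric.hausdorffEDist (⋃ i, sgMap k i '' (A : Set Plane)) (⋃ i, sgMap k i '' (B : Set Plane))
    ≤ _ * Metric.hausdorffEDist (A : Set Plane) (B : Set Plane)
  refine Metric.hausdorffEDist_iUnion_le.trans (iSup_le fun i => ?_)
  refine Metric.hausdorffEDist_le_of_infEDist ?_ ?_
  · rintro _ ⟨x, hx, rfl⟩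
    refine (infEDist_image_le (edist_sgMap k i) (by norm_num) x _).trans ?_
    gcongr
    exact Metric.infEDist_le_hausdorffEDist_of_mem hx
  · rintro _ ⟨x, hx, rfl⟩
    refine (infEDist_image_le (edist_sgMap k i) (by norm_num) x _).trans ?_
    gcongr
    rw [Metric.hausdorffEDist_comm]
    exact Metric.infEDist_le_hausdorffEDist_of_mem hx

/-- The system of the three contractions has an attractor. -/
theorem exists_isAttractor_sgMap (k : Fin 3 → Plane) :
    ∃ A : NonemptyCompacts Plane, IsAttractor (sgMap k) A := by
  have hc := contracting_sgHutchinson k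
  have : Nonempty (NonemptyCompacts Plane) := ⟨{(0 : Plane)}⟩
  refine ⟨hc.fixedPoint, ?_, ?_, ?_⟩
  · rw [← coe_sgHutchinson]
    exact congrArg _ hc.fixedPoint_isFixedPt
  · intro B hB
    exact hc.fixedPoint_unique (SetLike.coe_injective hB)
  · intro B
    have h := hc.tendsto_iterate_fixedPoint B
    rw [tendsto_iff_edist_tendsto_0] at h
    refine h.congr fun n => ?_
    rw [← coe_sgHutchinson_iterate]
    rfl

/-- The Sierpiński gasket: the attractor of the maps `x ↦ (x + k i) / 2`, `i = 0, 1, 2`. -/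
def sierpinskiGasket (k : Fin 3 → Plane) : Set Plane :=
  ((exists_isAttractor_sgMap k).choose : Set Plane)

theorem sierpinskiGasket_spec (k : Fin 3 → Plane) :
    ∃ A : NonemptyCompacts Plane, IsAttractor (sgMap k) A ∧ sierpinskiGasket k = A :=
  ⟨_, (exists_isAttractor_sgMap k).choose_spec, rfl⟩

/-- The maps `l_ω`, `ω ∈ {1,2,3}ⁿ`, whose attractor is again the gasket. -/
def sgWordMap (k : Fin 3 → Plane) (n : ℕ) : (Fin n → Fin 3) → Plane → Plane :=
  fun ω => wordMap (sgMap k) ω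

/-- The vertex set `V_n = ⋃_{ω ∈ {1,2,3}ⁿ} l_ω(V_0)`, where `V_0 = {k 0, k 1, k 2}`. -/
def sgVertices (k : Fin 3 → Plane) (n : ℕ) : Set Plane :=
  ⋃ ω : Fin n → Fin 3, sgWordMap k n ω '' range k

/-! ## Fractal interpolation functions -/

/-- The uniform norm on `K`. -/
def supNorm {X : Type*} (K : Set X) (g : X → ℝ) : ℝ :=
  sSup ((fun x => |g x|) '' K)

/-- `f` is the fractal interpolation function on `K` for the maps `l i`, the boundary `V₀`, the data
`p` on `V = ⋃ i, l i '' V₀`, the scale functions `s i` and the functions `q i`. Only the values of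
`p` on `V` and the values of `s i`, `q i`, `f` on `K` matter. -/
structure IsFIF {ι X : Type*} [TopologicalSpace X] (l : ι → X → X) (K V₀ : Set X)
    (p : X → ℝ) (s q : ι → X → ℝ) (f : X → ℝ) : Prop where
  continuousOn_s : ∀ i, ContinuousOn (s i) K
  supNorm_s_lt : ∀ i, supNorm K (s i) < 1
  continuousOn_q : ∀ i, ContinuousOn (q i) K
  joinUp : ∀ i, ∀ v ∈ V₀, q i v = p (l i v) - s i v * p v
  continuousOn_f : ContinuousOn f K
  interpolates : ∀ v ∈ ⋃ i, l i '' V₀, f v = p v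
  selfReferential : ∀ i, ∀ x ∈ K, f (l i x) = s i x * f x + q i x

/-! ## Affine, concave and convex functions on a set, and the numbers `γ` -/

/-- `g` is constant on `K`. -/
def IsConstOn {X : Type*} (K : Set X) (g : X → ℝ) : Prop :=
  ∃ c : ℝ, ∀ x ∈ K, g x = c

/-- `g` is a non-negative constant on `K`. -/
def IsNonnegConstOn {X : Type*} (K : Set X) (g : X → ℝ) : Prop :=
  ∃ c : ℝ, 0 ≤ c ∧ ∀ x ∈ K, g x = c

/-- `g` agrees on `K` with an affine function on the plane. -/
def IsAffineOn (K : Set Plane) (g : Plane → ℝ) : Prop :=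
  ∃ a : Plane →ᵃ[ℝ] ℝ, ∀ x ∈ K, g x = a x

/-- Concavity on a set that need not be convex: the concavity inequality holds whenever the two
points and their convex combination lie in `K`. -/
def IsConcaveOn (K : Set Plane) (g : Plane → ℝ) : Prop :=
  ∀ x ∈ K, ∀ y ∈ K, ∀ t ∈ Icc (0 : ℝ) 1, (1 - t) • x + t • y ∈ K →
    (1 - t) * g x + t * g y ≤ g ((1 - t) • x + t • y)

/-- Convexity on a set that need not be convex. -/
def IsConvexOn (K : Set Plane) (g : Plane → ℝ) : Prop :=
  ∀ x ∈ K, ∀ y ∈ K, ∀ t ∈ Icc (0 : ℝ) 1, (1 - t) • x + t • y ∈ K →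
    g ((1 - t) • x + t • y) ≤ (1 - t) * g x + t * g y

/-- `γ = ∑ i, ‖s i‖_∞`. -/
def gammaSup {ι : Type*} [Fintype ι] (K : Set Plane) (s : ι → Plane → ℝ) : ℝ :=
  ∑ i, supNorm K (s i)

open Classical in
/-- The sum of `|s i|` over those `i` for which `s i` is a constant and `q i` is affine
(for a constant function, `|s i|` is its uniform norm). -/
def gammaAffine {ι : Type*} [Fintype ι] (K : Set Plane) (s q : ι → Plane → ℝ) : ℝ :=
  ∑ i, if IsConstOn K (s i) ∧ IsAffineOn K (q i) then supNorm K (s i) else 0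

open Classical in
/-- The sum of `s i` over those `i` for which `s i` is a non-negative constant and `q i` is concave
(a non-negative constant is its own uniform norm). -/
def gammaConcave {ι : Type*} [Fintype ι] (K : Set Plane) (s q : ι → Plane → ℝ) : ℝ :=
  ∑ i, if IsNonnegConstOn K (s i) ∧ IsConcaveOn K (q i) then supNorm K (s i) else 0

open Classical in
/-- The sum of `s i` over those `i` for which `s i` is a non-negative constant and `q i` is
convex. -/
def gammaConvex {ι : Type*} [Fintype ι] (K : Set Plane) (s q : ι → Plane → ℝ) : ℝ :=
  ∑ i, if IsNonnegConstOn K (s i) ∧ IsConvexOn K (q i) then supNorm K (s i) else 0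

/-! ## Oscillation spaces -/

/-- The oscillation of `g` over `S`. -/
def osc {X : Type*} (g : X → ℝ) (S : Set X) : ℝ :=
  sSup (g '' S) - sInf (g '' S)

/-- The total oscillation of order `m`: the sum over words `ω` of length `m` of the oscillation of
`g` over `l_ω(K)`. -/
def totalOsc {ι X : Type*} [Fintype ι] (l : ι → X → X) (K : Set X) (m : ℕ) (g : X → ℝ) : ℝ :=
  ∑ ω : Fin m → ι, osc g (wordMap l ω '' K)

/-- The oscillation space `C^η(K)` of the system `l`, where `1 / Λ` is the largest contraction ratio
of the maps `l i`: continuous `g` for which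
`sup_{m ≥ 1} Osc(m, g) / Λ^{m (log_Λ N - η)}` is finite, `N` being the number of maps. -/
def InOscSpace {ι X : Type*} [Fintype ι] [TopologicalSpace X] (l : ι → X → X) (K : Set X)
    (Λ η : ℝ) (g : X → ℝ) : Prop :=
  ContinuousOn g K ∧
    BddAbove {t : ℝ | ∃ m : ℕ, 1 ≤ m ∧
      t = totalOsc l K m g / Λ ^ ((m : ℝ) * (Real.logb Λ (Fintype.card ι) - η))}

/-! ## Box dimension -/

/-- The graph of `f` over `K`, as a subset of three-dimensional space. -/
def graphOver (K : Set Plane) (f : Plane → ℝ) : Set (EuclideanSpace ℝ (Fin 3)) :=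
  (fun x : Plane => !₂[x 0, x 1, f x]) '' K

/-- The closed box with sides of length `δ` parallel to the axes and lowest corner `c`. -/
def box {m : ℕ} (δ : ℝ) (c : EuclideanSpace ℝ (Fin m)) : Set (EuclideanSpace ℝ (Fin m)) :=
  {x | ∀ i, c i ≤ x i ∧ x i ≤ c i + δ}

/-- The least number of axis-parallel boxes of side length `δ` whose union contains `F`. -/
def boxCount {m : ℕ} (δ : ℝ) (F : Set (EuclideanSpace ℝ (Fin m))) : ℕ :=
  sInf {N : ℕ | ∃ c : Fin N → EuclideanSpace ℝ (Fin m), F ⊆ ⋃ j, box δ (c j)}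

/-- The lower box dimension of a nonempty bounded set. -/
def lowerBoxDim {m : ℕ} (F : Set (EuclideanSpace ℝ (Fin m))) : EReal :=
  liminf (fun δ : ℝ => ((Real.log (boxCount δ F) / Real.log (1 / δ) : ℝ) : EReal)) (𝓝[>] 0)

/-- The upper box dimension of a nonempty bounded set. -/
def upperBoxDim {m : ℕ} (F : Set (EuclideanSpace ℝ (Fin m))) : EReal :=
  limsup (fun δ : ℝ => ((Real.log (boxCount δ F) / Real.log (1 / δ) : ℝ) : EReal)) (𝓝[>] 0)

/-- The box dimension of `F` exists and equals `d`. -/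
def HasBoxDim {m : ℕ} (F : Set (EuclideanSpace ℝ (Fin m))) (d : ℝ) : Prop :=
  lowerBoxDim F = (d : EReal) ∧ upperBoxDim F = (d : EReal)

end SGFIF

end

open SGFIF

namespace SGFIF

/-! ## Words and cells -/

section Words

variable {ι X : Type*} {f : ι → X → X} {K : Set X}

/-! Write `Osc(m)` for `totalOsc … m f`. At scale `δ ≈ 2^(-nm)` the box count of the graph is
comparable to `3^(nm) + 2^(nm) Osc(m)`. Above each of the `3^(nm)` cells the graph is a column;
since the gasket is connected, `f` fills an interval there, so a column needs about `max 1 (osc /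
δ)` boxes, while one box meets boundedly many columns because the cells sit at distinct points of a
planar lattice. These are `sum_max_osc_le_boxCount` and `boxCount_le_sum_osc`. Only the growth rate
of `Osc(m)` remains to be found.

Upper bound: the self-referential equation gives `Osc(m+1) ≤ γ Osc(m) + C ρ^m`, where `ρ ≤ (3 /
2^η')^n` comes from the oscillation spaces of `s i` and `q i`. Hence `Osc(m) = O(A^m)` for every `A`
above both `γ` and `ρ`, and `A` is then lowered to its limit.

Lower bound: follow the deviation of `f` from linearity at `y₁, y₂, y₃`, which equals `L`. Where `s
i` is a constant `σ`, passing to `l i` multiplies the deviation by `σ` and adds that of `q i`. The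
latter is zero for affine `q i`; for concave or convex `q i` it has a fixed sign, which reinforces
`L` if `σ ≥ 0`. Summing over words gives `|L| γ₀^m ≤ Osc(m)` for the relevant partial sum `γ₀`
(`mul_pow_le_totalOsc`). The value `log 3 / log 2` is already forced by the number of cells. -/

theorem wordMap_succ {m : ℕ} (ω : Fin (m + 1) → ι) (x : X) :
    wordMap f ω x = f (ω 0) (wordMap f (Fin.tail ω) x) := rfl

theorem wordMap_cons {m : ℕ} (i : ι) (ω : Fin m → ι) (x : X) :
    wordMap f (Fin.cons i ω : Fin (m + 1) → ι) x = f i (wordMap f ω x) := by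
  rw [wordMap_succ, Fin.cons_zero, Fin.tail_cons]

theorem mapsTo_of_hutchinson (h : hutchinson f K = K) (i : ι) : MapsTo (f i) K K := by
  intro x hx
  rw [← h]
  exact mem_iUnion.2 ⟨i, x, hx, rfl⟩

theorem mapsTo_wordMap (h : ∀ i, MapsTo (f i) K K) {m : ℕ} (ω : Fin m → ι) :
    MapsTo (wordMap f ω) K K := by
  induction m with
  | zero => exact fun x hx => hx
  | succ m ih => exact (h _).comp (ih _)

theorem hutchinson_wordMap (h : hutchinson f K = K) (m : ℕ) :
    hutchinson (fun ω : Fin m → ι => wordMap f ω) K = K := by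
  refine Subset.antisymm (iUnion_subset fun ω =>
    (mapsTo_wordMap (mapsTo_of_hutchinson h) ω).image_subset) ?_
  induction m with
  | zero => exact fun x hx => mem_iUnion.2 ⟨Fin.elim0, x, hx, rfl⟩
  | succ m ih =>
    intro x hx
    rw [← h] at hx
    obtain ⟨i, y, hy, rfl⟩ := mem_iUnion.1 hx
    obtain ⟨ω, z, hz, rfl⟩ := mem_iUnion.1 (ih hy)
    exact mem_iUnion.2 ⟨Fin.cons i ω, z, hz, wordMap_cons i ω z⟩

end Words

/-! ### Cells as points of a lattice -/

/-- The maps `l i` are `x ↦ (x + c + a i • u + b i • w) / r` with pairwise distinct pairs of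
base-`r` digits `(a i, b i)`. -/
def IsDigitIFS {ι E : Type*} [AddCommGroup E] [Module ℝ E] (l : ι → E → E) (u w : E) (r : ℕ) :
    Prop :=
  ∃ (c : E) (a b : ι → ℕ), (∀ i, a i < r) ∧ (∀ i, b i < r) ∧
    Function.Injective (fun i => (a i, b i)) ∧
    ∀ i x, l i x = (r : ℝ)⁻¹ • (x + c + (a i : ℝ) • u + (b i : ℝ) • w)

/-- Composition concatenates digit strings: the outermost map supplies the leading digit, with
weight `r ^ m`, and quotient and remainder by `r ^ m` recover the parts, so distinct words keep
distinct digit pairs. -/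
theorem IsDigitIFS.wordMap {ι E : Type*} [AddCommGroup E] [Module ℝ E] {l : ι → E → E} {u w : E}
    {r : ℕ} (h : IsDigitIFS l u w r) (hr : 0 < r) (m : ℕ) :
    IsDigitIFS (fun ω : Fin m → ι => wordMap l ω) u w (r ^ m) := by
  obtain ⟨c, a, b, ha, hb, hinj, hl⟩ := h
  induction m with
  | zero =>
    refine ⟨0, fun _ => 0, fun _ => 0, by simp, by simp, fun _ _ _ => Subsingleton.elim _ _, ?_⟩
    intro i x
    simp [SGFIF.wordMap]
  | succ m ih =>
    obtain ⟨C, A, B, hA, hB, hAB, hL⟩ := ih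
    have hR : 0 < r ^ m := pow_pos hr m
    have key : ∀ {x y x' y' : ℕ}, y < r ^ m → y' < r ^ m → r ^ m * x + y = r ^ m * x' + y' →
        x = x' ∧ y = y' := by
      intro x y x' y' hy hy' he
      have h1 := congrArg (· / r ^ m) he
      have h2 := congrArg (· % r ^ m) he
      simp only [Nat.mul_add_div hR, Nat.div_eq_of_lt hy, Nat.div_eq_of_lt hy', add_zero] at h1
      simp only [Nat.mul_add_mod, Nat.mod_eq_of_lt hy, Nat.mod_eq_of_lt hy'] at h2
      exact ⟨h1, h2⟩
    have bound : ∀ {x y : ℕ}, x < r → y < r ^ m → r ^ m * x + y < r ^ (m + 1) := by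
      intro x y hx hy
      calc r ^ m * x + y < r ^ m * x + r ^ m := by omega
        _ = r ^ m * (x + 1) := by ring
        _ ≤ r ^ m * r := Nat.mul_le_mul_left _ hx
        _ = r ^ (m + 1) := (pow_succ _ _).symm
    refine ⟨C + (r ^ m : ℝ) • c, fun ω => r ^ m * a (ω 0) + A (Fin.tail ω),
      fun ω => r ^ m * b (ω 0) + B (Fin.tail ω), fun ω => bound (ha _) (hA _),
      fun ω => bound (hb _) (hB _), ?_, ?_⟩
    · intro ω ω' he
      simp only [Prod.mk.injEq] at he
      obtain ⟨h1, h2⟩ := key (hA _) (hA _) he.1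
      obtain ⟨h3, h4⟩ := key (hB _) (hB _) he.2
      rw [← Fin.cons_self_tail ω, ← Fin.cons_self_tail ω', hinj (Prod.ext h1 h3),
        hAB (Prod.ext h2 h4)]
    · intro ω x
      have hr' : (r : ℝ) ≠ 0 := by positivity
      have hLω := hL (Fin.tail ω) x
      simp only at hLω ⊢
      rw [wordMap_succ, hl, hLω]
      push_cast
      match_scalars <;> field_simp <;> ring

theorem IsDigitIFS.dist_eq {ι E : Type*} [NormedAddCommGroup E] [NormedSpace ℝ E] {l : ι → E → E}
    {u w : E} {r : ℕ} (h : IsDigitIFS l u w r) (i : ι) (x y : E) :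
    dist (l i x) (l i y) = (r : ℝ)⁻¹ * dist x y := by
  obtain ⟨c, a, b, -, -, -, hl⟩ := h
  rw [hl, hl, dist_smul₀, add_assoc, add_assoc, add_assoc, add_assoc, dist_add_right]
  simp

theorem IsDigitIFS.lineMap_eq {ι E : Type*} [NormedAddCommGroup E] [NormedSpace ℝ E]
    {l : ι → E → E} {u w : E} {r : ℕ} (h : IsDigitIFS l u w r) (i : ι) (t : ℝ) (x y : E) :
    l i ((1 - t) • x + t • y) = (1 - t) • l i x + t • l i y := by
  obtain ⟨c, a, b, -, -, -, hl⟩ := h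
  rw [hl, hl, hl]
  match_scalars <;> ring

/-- Boundedly many of the cells of a digit system meet a set of diameter comparable to theirs. -/
theorem IsDigitIFS.card_le {ι E : Type*} [Fintype ι] [NormedAddCommGroup E] [NormedSpace ℝ E]
    {l : ι → E → E}
    {u w : E} {r : ℕ} (h : IsDigitIFS l u w r) (hr : 0 < r) {Q : ℕ} {D : ℝ}
    (huw : ∀ x y : ℝ, ‖x • u + y • w‖ ≤ D → |x| ≤ Q ∧ |y| ≤ Q)
    {K : Set E} {d δ : ℝ} (hK : ∀ x ∈ K, ∀ y ∈ K, dist x y ≤ d) (hD : d + r * δ ≤ D)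
    {S : Set E} (hS : ∀ x ∈ S, ∀ y ∈ S, dist x y ≤ δ) (I : Finset ι)
    (hI : ∀ i ∈ I, (l i '' K ∩ S).Nonempty) :
    I.card ≤ (2 * Q + 1) ^ 2 := by
  obtain ⟨c, a, b, -, -, hinj, hl⟩ := h
  have hr' : (0 : ℝ) < r := by exact_mod_cast hr
  rcases I.eq_empty_or_nonempty with rfl | ⟨i₀, hi₀⟩
  · simp
  -- Magnified by `r`, the offset between two cells meeting `S` has norm at most `d + r * δ`, so its
  -- lattice coordinates are at most `Q`.
  have close : ∀ i ∈ I, |(a i : ℝ) - a i₀| ≤ Q ∧ |(b i : ℝ) - b i₀| ≤ Q := by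
    intro i hi
    obtain ⟨_, ⟨x, hx, rfl⟩, hxS⟩ := hI i hi
    obtain ⟨_, ⟨y, hy, rfl⟩, hyS⟩ := hI i₀ hi₀
    apply huw
    have e : ((a i : ℝ) - a i₀) • u + ((b i : ℝ) - b i₀) • w
        = (y - x) + (r : ℝ) • (l i x - l i₀ y) := by
      rw [hl, hl]
      match_scalars <;> field_simp <;> ring
    rw [e]
    refine (norm_add_le _ _).trans (le_trans (add_le_add ?_ ?_) hD)
    · rw [← dist_eq_norm]; exact hK _ hy _ hx
    · rw [norm_smul, Real.norm_of_nonneg hr'.le, ← dist_eq_norm]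
      exact mul_le_mul_of_nonneg_left (hS _ hxS _ hyS) hr'.le
  -- Truncated subtraction only shortens these intervals, so each still has at most `2 * Q + 1`
  -- elements.
  have hmaps : ∀ i ∈ I, (a i, b i) ∈
      Finset.Icc (a i₀ - Q) (a i₀ + Q) ×ˢ Finset.Icc (b i₀ - Q) (b i₀ + Q) := by
    intro i hi
    obtain ⟨h1, h2⟩ := close i hi
    rw [abs_le] at h1 h2
    have h3 : (a i : ℝ) ≤ (a i₀ + Q : ℕ) := by push_cast; linarith
    have h4 : (b i : ℝ) ≤ (b i₀ + Q : ℕ) := by push_cast; linarith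
    have h5 : (a i₀ : ℝ) ≤ (a i + Q : ℕ) := by push_cast; linarith
    have h6 : (b i₀ : ℝ) ≤ (b i + Q : ℕ) := by push_cast; linarith
    have h3 := Nat.cast_le.1 h3
    have h4 := Nat.cast_le.1 h4
    have h5 := Nat.cast_le.1 h5
    have h6 := Nat.cast_le.1 h6
    simp only [Finset.mem_product, Finset.mem_Icc]
    omega
  refine (Finset.card_le_card_of_injOn _ hmaps hinj.injOn).trans ?_
  rw [Finset.card_product, Nat.card_Icc, Nat.card_Icc, sq]
  gcongr <;> omega

/-! ## The gasket -/

section Gasket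

variable (k : Fin 3 → Plane)

theorem isDigitIFS_sgMap : IsDigitIFS (sgMap k) (k 1 - k 0) (k 2 - k 0) 2 := by
  refine ⟨k 0, ![0, 1, 0], ![0, 0, 1], by decide, by decide, by decide, fun i x => ?_⟩
  fin_cases i <;> simp [sgMap]

theorem isDigitIFS_sgWordMap (n : ℕ) :
    IsDigitIFS (sgWordMap k n) (k 1 - k 0) (k 2 - k 0) (2 ^ n) :=
  (isDigitIFS_sgMap k).wordMap two_pos n

theorem isCompact_sierpinskiGasket : IsCompact (sierpinskiGasket k) := by
  obtain ⟨A, -, h⟩ := sierpinskiGasket_spec k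
  rw [h]; exact A.isCompact

theorem nonempty_sierpinskiGasket : (sierpinskiGasket k).Nonempty := by
  obtain ⟨A, -, h⟩ := sierpinskiGasket_spec k
  rw [h]; exact A.nonempty

theorem hutchinson_sierpinskiGasket :
    hutchinson (sgMap k) (sierpinskiGasket k) = sierpinskiGasket k := by
  obtain ⟨A, hA, h⟩ := sierpinskiGasket_spec k
  rw [h]; exact hA.fixed

theorem hutchinson_sgWordMap_sierpinskiGasket (n : ℕ) :
    hutchinson (sgWordMap k n) (sierpinskiGasket k) = sierpinskiGasket k :=
  hutchinson_wordMap (hutchinson_sierpinskiGasket k) n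

/-- `k i` is the fixed point of the contraction `sgMap k i`, hence a limit of iterates that stay in
the closed gasket. -/
theorem vertex_mem_sierpinskiGasket (i : Fin 3) : k i ∈ sierpinskiGasket k := by
  obtain ⟨x, hx⟩ := nonempty_sierpinskiGasket k
  have hmem : ∀ m : ℕ, (sgMap k i)^[m] x ∈ sierpinskiGasket k := fun m =>
    (mapsTo_of_hutchinson (hutchinson_sierpinskiGasket k) i).iterate m hx
  have hd : ∀ m : ℕ, dist ((sgMap k i)^[m] x) (k i) = (1 / 2 : ℝ) ^ m * dist x (k i) := by
    intro m
    induction m with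
    | zero => simp
    | succ m ih =>
      have hfix : sgMap k i (k i) = k i := by
        unfold sgMap; match_scalars; norm_num
      rw [Function.iterate_succ_apply']
      conv_lhs => rw [← hfix]
      rw [(isDigitIFS_sgMap k).dist_eq, ih]
      push_cast; ring
  refine (isCompact_sierpinskiGasket k).isClosed.mem_of_tendsto (b := atTop)
    (f := fun m => (sgMap k i)^[m] x) ?_ (Eventually.of_forall hmem)
  rw [tendsto_iff_dist_tendsto_zero]
  simp_rw [hd]
  simpa using (tendsto_pow_atTop_nhds_zero_of_lt_one (by norm_num : (0 : ℝ) ≤ 1 / 2)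
    (by norm_num)).mul_const (dist x (k i))

theorem sgVertices_subset (n : ℕ) : sgVertices k n ⊆ sierpinskiGasket k := by
  refine iUnion_subset fun ω => ?_
  rintro _ ⟨_, ⟨i, rfl⟩, rfl⟩
  exact mapsTo_of_hutchinson (hutchinson_sgWordMap_sierpinskiGasket k n) ω
    (vertex_mem_sierpinskiGasket k i)

/-- A function that is constant on each of the cells of some level is constant on the gasket. -/
theorem eq_of_eqOn_cells {Y : Type*} {g : Plane → Y} {m : ℕ}
    (hg : ∀ ω : Fin m → Fin 3, ∀ x ∈ sierpinskiGasket k, ∀ y ∈ sierpinskiGasket k,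
      g (wordMap (sgMap k) ω x) = g (wordMap (sgMap k) ω y)) :
    ∀ x ∈ sierpinskiGasket k, ∀ y ∈ sierpinskiGasket k, g x = g y := by
  induction m generalizing g with
  | zero => exact hg Fin.elim0
  | succ m ih =>
    have hcell : ∀ i, ∀ x ∈ sierpinskiGasket k, ∀ y ∈ sierpinskiGasket k,
        g (sgMap k i x) = g (sgMap k i y) := fun i =>
      ih (g := fun x => g (sgMap k i x)) fun ω x hx y hy => by
        simpa only [wordMap_cons] using hg (Fin.cons i ω) x hx y hy
    -- Any two first-level cells share this point, which links their constant values.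
    have hcross : ∀ i j, sgMap k i (k j) = sgMap k j (k i) := fun i j => by
      unfold sgMap; rw [add_comm]
    have hv := vertex_mem_sierpinskiGasket k
    intro x hx y hy
    rw [← hutchinson_sierpinskiGasket k] at hx hy
    obtain ⟨i, x', hx', rfl⟩ := mem_iUnion.1 hx
    obtain ⟨j, y', hy', rfl⟩ := mem_iUnion.1 hy
    rw [hcell i x' hx' (k j) (hv j), hcross, hcell j y' hy' (k i) (hv i)]

/-- The parts of a closed separation would lie at positive distance; cells of smaller diameter fall
into one part each, so membership is constant on cells and `eq_of_eqOn_cells` applies. -/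
theorem isConnected_sierpinskiGasket : IsConnected (sierpinskiGasket k) := by
  refine ⟨nonempty_sierpinskiGasket k, ?_⟩
  have hK := isCompact_sierpinskiGasket k
  rw [isPreconnected_iff_subset_of_disjoint_closed]
  intro u v hu hv huv hdis
  obtain ⟨ε, hε, hsep⟩ := Metric.exists_pos_forall_lt_edist (hK.inter_right hu)
    (hK.isClosed.inter hv) (by
      rw [Set.disjoint_left]
      rintro x ⟨hx, hxu⟩ ⟨-, hxv⟩
      exact hdis.subset ⟨hx, hxu, hxv⟩)
  obtain ⟨d, hd⟩ := (Metric.isBounded_iff.1 hK.isBounded)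
  obtain ⟨m, hm⟩ : ∃ m : ℕ, (1 / 2 : ℝ) ^ m * d < ε := by
    have := (tendsto_pow_atTop_nhds_zero_of_lt_one (by norm_num : (0 : ℝ) ≤ 1 / 2)
      (by norm_num)).mul_const d
    rw [zero_mul] at this
    exact (this.eventually_lt_const (by exact_mod_cast hε)).exists
  have hconst := eq_of_eqOn_cells k (g := fun x => x ∈ u) (m := m) (by
    have aux : ∀ ω : Fin m → Fin 3, ∀ x ∈ sierpinskiGasket k, ∀ y ∈ sierpinskiGasket k,
        wordMap (sgMap k) ω x ∈ u → wordMap (sgMap k) ω y ∈ u := by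
      intro ω x hx y hy hxu
      have hmaps := mapsTo_wordMap (mapsTo_of_hutchinson (hutchinson_sierpinskiGasket k)) ω
      by_contra hyu
      have hyv : wordMap (sgMap k) ω y ∈ v := (huv (hmaps hy)).resolve_left hyu
      have h1 := hsep _ ⟨hmaps hx, hxu⟩ _ ⟨hmaps hy, hyv⟩
      rw [edist_nndist, ENNReal.coe_lt_coe, ← NNReal.coe_lt_coe, coe_nndist] at h1
      have h2 := ((isDigitIFS_sgMap k).wordMap two_pos m).dist_eq ω x y
      have h3 : dist (wordMap (sgMap k) ω x) (wordMap (sgMap k) ω y) ≤ (1 / 2 : ℝ) ^ m * d := by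
        rw [h2]
        push_cast
        rw [one_div, inv_pow]
        exact mul_le_mul_of_nonneg_left (hd hx hy) (by positivity)
      linarith
    exact fun ω x hx y hy => propext ⟨aux ω x hx y hy, aux ω y hy x hx⟩)
  obtain ⟨x₀, hx₀⟩ := nonempty_sierpinskiGasket k
  by_cases h : x₀ ∈ u
  · exact Or.inl fun x hx => (hconst x₀ hx₀ x hx).mp h
  · exact Or.inr fun x hx => (huv hx).resolve_left fun hxu => h ((hconst x hx x₀ hx₀).mp hxu)

variable {k}

/-- For side `a` the edges have inner product `a² / 2`, so the squared norm is `a² (x² + x y + y²)`;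
completing the square bounds `x²` and `y²` by four times the form, whence `2 * D / a`. -/
theorem IsEquilateral.exists_coord_bound (hk : IsEquilateral k) (D : ℝ) :
    ∃ Q : ℕ, ∀ x y : ℝ, ‖x • (k 1 - k 0) + y • (k 2 - k 0)‖ ≤ D → |x| ≤ Q ∧ |y| ≤ Q := by
  obtain ⟨a, ha, hd⟩ := hk
  obtain ⟨Q, hQ⟩ := exists_nat_ge (2 * D / a)
  refine ⟨Q, fun x y h => ?_⟩
  have hD : 0 ≤ D := (norm_nonneg _).trans h
  set u := k 1 - k 0
  set w := k 2 - k 0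
  have hu : ‖u‖ = a := by rw [← dist_eq_norm]; exact hd _ _ (by decide)
  have hw : ‖w‖ = a := by rw [← dist_eq_norm]; exact hd _ _ (by decide)
  have huw : ‖u - w‖ = a := by
    rw [← hd 1 2 (by decide), dist_eq_norm]; congr 1; simp [u, w]
  have hin : inner ℝ u w = a ^ 2 / 2 := by
    have := norm_sub_sq_real u w
    rw [hu, hw, huw] at this
    linarith
  have hsq : ‖x • u + y • w‖ ^ 2 = a ^ 2 * (x ^ 2 + x * y + y ^ 2) := by
    rw [norm_add_sq_real, norm_smul, norm_smul, hu, hw, real_inner_smul_left,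
      real_inner_smul_right, hin, mul_pow, mul_pow, Real.norm_eq_abs, Real.norm_eq_abs, sq_abs,
      sq_abs]
    ring
  have hle : a ^ 2 * (x ^ 2 + x * y + y ^ 2) ≤ D ^ 2 := by
    rw [← hsq]; exact pow_le_pow_left₀ (norm_nonneg _) h 2
  have hfin : ∀ z : ℝ, z ^ 2 ≤ 4 * (x ^ 2 + x * y + y ^ 2) → |z| ≤ Q := by
    intro z hz
    refine le_trans ?_ hQ
    rw [le_div_iff₀ ha]
    apply abs_le_of_sq_le_sq' _ (by positivity) |>.2
    rw [mul_pow, sq_abs]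
    nlinarith [sq_nonneg a]
  exact ⟨hfin x (by nlinarith [sq_nonneg (x + 2 * y), sq_nonneg x]),
    hfin y (by nlinarith [sq_nonneg (y + 2 * x), sq_nonneg y])⟩

end Gasket

/-! ## Oscillation -/

section Osc

variable {X : Type*}

theorem osc_nonneg {g : X → ℝ} {S : Set X} (hb : BddBelow (g '' S)) (ha : BddAbove (g '' S)) :
    0 ≤ osc g S := by
  rcases S.eq_empty_or_nonempty with rfl | hS
  · simp [osc]
  · exact sub_nonneg.2 (csInf_le_csSup (hS.image g) hb ha)

theorem abs_sub_le_osc {g : X → ℝ} {S : Set X} (hb : BddBelow (g '' S)) (ha : BddAbove (g '' S))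
    {x y : X} (hx : x ∈ S) (hy : y ∈ S) : |g x - g y| ≤ osc g S := by
  have h1 := csInf_le hb (mem_image_of_mem g hx)
  have h2 := csInf_le hb (mem_image_of_mem g hy)
  have h3 := le_csSup ha (mem_image_of_mem g hx)
  have h4 := le_csSup ha (mem_image_of_mem g hy)
  rw [abs_le]
  constructor <;> unfold osc <;> linarith

theorem osc_le {g : X → ℝ} {S : Set X} (hS : S.Nonempty) {C : ℝ}
    (h : ∀ x ∈ S, ∀ y ∈ S, g x - g y ≤ C) : osc g S ≤ C := by
  have h1 : ∀ y ∈ S, sSup (g '' S) ≤ C + g y := fun y hy => csSup_le (hS.image g) (by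
    rintro _ ⟨x, hx, rfl⟩; linarith [h x hx y hy])
  have h2 : sSup (g '' S) - C ≤ sInf (g '' S) := le_csInf (hS.image g) (by
    rintro _ ⟨y, hy, rfl⟩; linarith [h1 y hy])
  unfold osc; linarith

end Osc

/-! ## Box counts of graphs -/

theorem boxCount_le_card {d : ℕ} {δ : ℝ} {F : Set (EuclideanSpace ℝ (Fin d))} {J : Type*}
    [Fintype J] (c : J → EuclideanSpace ℝ (Fin d)) (h : F ⊆ ⋃ j, box δ (c j)) :
    boxCount δ F ≤ Fintype.card J := by
  refine Nat.sInf_le ⟨c ∘ (Fintype.equivFin J).symm, ?_⟩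
  exact h.trans_eq ((Fintype.equivFin J).symm.surjective.iUnion_comp
    (fun j => box δ (c j))).symm

/-- The natural-number infimum is attained only if some finite cover exists; compactness gives one
by balls of radius `δ / 2`, each inside a box of side `δ`. -/
theorem exists_box_cover {d : ℕ} {δ : ℝ} (hδ : 0 < δ) {F : Set (EuclideanSpace ℝ (Fin d))}
    (hF : IsCompact F) :
    ∃ c : Fin (boxCount δ F) → EuclideanSpace ℝ (Fin d), F ⊆ ⋃ j, box δ (c j) := by
  refine Nat.sInf_mem (s := {N : ℕ | ∃ c : Fin N → EuclideanSpace ℝ (Fin d),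
    F ⊆ ⋃ j, box δ (c j)}) ?_
  obtain ⟨t, -, ht, hcov⟩ := hF.finite_cover_balls (half_pos hδ)
  have := ht.fintype
  refine ⟨Fintype.card t, fun j => WithLp.toLp 2 fun i =>
    ((Fintype.equivFin t).symm j : EuclideanSpace ℝ (Fin d)) i - δ / 2, fun x hx => ?_⟩
  obtain ⟨y, hy, hxy⟩ := mem_iUnion₂.1 (hcov hx)
  refine mem_iUnion.2 ⟨Fintype.equivFin t ⟨y, hy⟩, fun i => ?_⟩
  have h := (PiLp.norm_apply_le (x - y) i).trans_lt (mem_ball_iff_norm.1 hxy)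
  rw [PiLp.sub_apply, Real.norm_eq_abs, abs_lt] at h
  simp only [Equiv.symm_apply_apply]
  constructor <;> linarith

theorem mem_box_graph {δ : ℝ} {c : EuclideanSpace ℝ (Fin 3)} {x : Plane} {z : ℝ} :
    (!₂[x 0, x 1, z] : EuclideanSpace ℝ (Fin 3)) ∈ box δ c ↔
      (c 0 ≤ x 0 ∧ x 0 ≤ c 0 + δ) ∧ (c 1 ≤ x 1 ∧ x 1 ≤ c 1 + δ) ∧ (c 2 ≤ z ∧ z ≤ c 2 + δ) := by
  simp only [box, mem_ofPred_eq, Fin.forall_fin_succ, IsEmpty.forall_iff, and_true]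
  rfl

theorem isCompact_graphOver {K : Set Plane} (hK : IsCompact K) {f : Plane → ℝ}
    (hf : ContinuousOn f K) : IsCompact (graphOver K f) := by
  refine hK.image_of_continuousOn ?_
  refine (PiLp.continuous_toLp 2 _).comp_continuousOn (continuousOn_pi.2 fun i => ?_)
  fin_cases i
  · exact (EuclideanSpace.proj (𝕜 := ℝ) (0 : Fin 2)).continuous.continuousOn
  · exact (EuclideanSpace.proj (𝕜 := ℝ) (1 : Fin 2)).continuous.continuousOn
  · exact hf

theorem sub_le_card_mul_of_Icc_subset {J : Type*} (s : Finset J) {a b δ : ℝ} (hδ : 0 ≤ δ)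
    (c : J → ℝ) (h : Icc a b ⊆ ⋃ j ∈ s, Icc (c j) (c j + δ)) : b - a ≤ s.card * δ := by
  have h1 := (MeasureTheory.measure_mono (μ := MeasureTheory.volume) h).trans
    (MeasureTheory.measure_biUnion_finset_le s _)
  simp only [Real.volume_Icc, add_sub_cancel_left, Finset.sum_const, nsmul_eq_mul] at h1
  rw [← ENNReal.ofReal_natCast, ← ENNReal.ofReal_mul (by positivity)] at h1
  exact (ENNReal.ofReal_le_ofReal_iff (by positivity)).1 h1

theorem dist_le_of_mem_square {a b δ : ℝ} {x y : Plane}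
    (hx : (a ≤ x 0 ∧ x 0 ≤ a + δ) ∧ (b ≤ x 1 ∧ x 1 ≤ b + δ))
    (hy : (a ≤ y 0 ∧ y 0 ≤ a + δ) ∧ (b ≤ y 1 ∧ y 1 ≤ b + δ)) : dist x y ≤ 2 * δ := by
  have hδ : 0 ≤ δ := by linarith [hx.1.1, hx.1.2]
  rw [EuclideanSpace.dist_eq, Fin.sum_univ_two, Real.dist_eq, Real.dist_eq, sq_abs, sq_abs]
  refine Real.sqrt_le_iff.2 ⟨by positivity, ?_⟩
  have h0 : (x 0 - y 0) ^ 2 ≤ δ ^ 2 := sq_le_sq' (by linarith) (by linarith)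
  have h1 : (x 1 - y 1) ^ 2 ≤ δ ^ 2 := sq_le_sq' (by linarith) (by linarith)
  nlinarith [sq_nonneg δ]

section BoxCount

variable {ι : Type*} [Fintype ι] {l : ι → Plane → Plane} {u w : Plane} {r : ℕ} {K : Set Plane}
  {f : Plane → ℝ} {d : ℝ}

-- Double counting of incidences between cells and covering boxes: column `i` meets at least `max 1
-- (osc / δ)` boxes, and a box meets at most `(2 * Q + 1) ^ 2` columns. In `d + 2`, the 2 bounds `r`
-- times the diameter `2 * δ` of the base of a box.
open Classical in
theorem sum_max_osc_le_boxCount (hl : IsDigitIFS l u w r) (hr : 0 < r) (hK : IsCompact K)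
    (hc : IsConnected K) (hmaps : ∀ i, MapsTo (l i) K K) (hf : ContinuousOn f K)
    (hd : ∀ x ∈ K, ∀ y ∈ K, dist x y ≤ d) {Q : ℕ}
    (huw : ∀ x y : ℝ, ‖x • u + y • w‖ ≤ d + 2 → |x| ≤ Q ∧ |y| ≤ Q) {δ : ℝ} (hδ : 0 < δ)
    (hrδ : r * δ ≤ 1) :
    ∑ i, max 1 (osc f (l i '' K) / δ) ≤ boxCount δ (graphOver K f) * (2 * Q + 1) ^ 2 := by
  obtain ⟨N, hN, c, hcov⟩ : ∃ N, N = boxCount δ (graphOver K f) ∧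
      ∃ c : Fin N → EuclideanSpace ℝ (Fin 3), graphOver K f ⊆ ⋃ j, box δ (c j) :=
    ⟨_, rfl, exists_box_cover hδ (isCompact_graphOver hK hf)⟩
  rw [← hN]
  let rel : ι → Fin N → Prop := fun i j =>
    ∃ x ∈ K, (!₂[l i x 0, l i x 1, f (l i x)] : EuclideanSpace ℝ (Fin 3)) ∈ box δ (c j)
  have hrel : ∀ i, ∀ x ∈ K, ∃ j, rel i j ∧ c j 2 ≤ f (l i x) ∧ f (l i x) ≤ c j 2 + δ := by
    intro i x hx
    obtain ⟨j, hj⟩ := mem_iUnion.1 (hcov ⟨l i x, hmaps i hx, rfl⟩)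
    exact ⟨j, ⟨x, hx, hj⟩, (mem_box_graph.1 hj).2.2⟩
  have hcont : ∀ i, ContinuousOn (l i) K := fun i => by
    refine (LipschitzWith.of_dist_le_mul (K := (r : NNReal)⁻¹) fun x y => ?_).continuous.continuousOn
    rw [hl.dist_eq]
    simp
  have hlow : ∀ i, max 1 (osc f (l i '' K) / δ)
      ≤ ((Finset.univ.bipartiteAbove rel i).card : ℝ) := by
    intro i
    refine max_le ?_ ?_
    · obtain ⟨x, hx⟩ := hc.nonempty
      obtain ⟨j, hj, -⟩ := hrel i x hx
      exact_mod_cast Finset.card_pos.2 ⟨j, (Finset.mem_bipartiteAbove _).2 ⟨Finset.mem_univ _, hj⟩⟩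
    · rw [div_le_iff₀ hδ]
      have hfi : ContinuousOn f (l i '' K) := hf.mono (hmaps i).image_subset
      -- Connectedness enters here: the values on a cell form an interval, so the vertical sides of
      -- its boxes have total length at least the oscillation.
      have hIcc := eq_Icc_of_connected_compact ((hc.image _ (hcont i)).image _ hfi)
        ((hK.image_of_continuousOn (hcont i)).image_of_continuousOn hfi)
      refine sub_le_card_mul_of_Icc_subset _ hδ.le (fun j => c j 2) ?_
      rw [← hIcc]
      rintro _ ⟨_, ⟨x, hx, rfl⟩, rfl⟩
      obtain ⟨j, hj, hj'⟩ := hrel i x hx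
      exact mem_iUnion₂.2 ⟨j, (Finset.mem_bipartiteAbove _).2 ⟨Finset.mem_univ _, hj⟩, hj'⟩
  have hup : ∀ j, (Finset.univ.bipartiteBelow rel j).card ≤ (2 * Q + 1) ^ 2 := by
    intro j
    refine hl.card_le hr huw hd (δ := 2 * δ) (by linarith)
      (S := {x | (c j 0 ≤ x 0 ∧ x 0 ≤ c j 0 + δ) ∧ (c j 1 ≤ x 1 ∧ x 1 ≤ c j 1 + δ)})
      (fun x hx y hy => dist_le_of_mem_square hx hy) _ fun i hi => ?_
    obtain ⟨x, hx, hxj⟩ := ((Finset.mem_bipartiteBelow _).1 hi).2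
    have := mem_box_graph.1 hxj
    exact ⟨l i x, ⟨x, hx, rfl⟩, this.1, this.2.1⟩
  calc ∑ i, max 1 (osc f (l i '' K) / δ)
      ≤ ∑ i, ((Finset.univ.bipartiteAbove rel i).card : ℝ) := Finset.sum_le_sum fun i _ => hlow i
    _ = ((∑ j, (Finset.univ.bipartiteBelow rel j).card : ℕ) : ℝ) := by
        rw [← Finset.sum_card_bipartiteAbove_eq_sum_card_bipartiteBelow, Nat.cast_sum]
    _ ≤ ((∑ _j : Fin N, (2 * Q + 1) ^ 2 : ℕ) : ℝ) :=
        Nat.cast_le.2 (Finset.sum_le_sum fun j _ => hup j)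
    _ = N * (2 * Q + 1) ^ 2 := by simp

theorem exists_mem_subinterval {a y ε δ : ℝ} (hε : 0 < ε) (hδ : ε ≤ δ) {M : ℕ} (h1 : a ≤ y)
    (h2 : y ≤ a + M * ε) : ∃ j : Fin (M + 1), a + j * ε ≤ y ∧ y ≤ a + j * ε + δ := by
  have h0 : 0 ≤ (y - a) / ε := div_nonneg (by linarith) hε.le
  have hle : (y - a) / ε ≤ M := by rw [div_le_iff₀ hε]; linarith
  -- The floor equals `M` at the right endpoint, hence `M + 1` starting points.
  refine ⟨⟨⌊(y - a) / ε⌋₊, Nat.lt_succ_of_le (Nat.floor_le_of_le hle)⟩, ?_, ?_⟩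
  · have := Nat.floor_le h0
    rw [le_div_iff₀ hε] at this
    simp only; linarith
  · have := (Nat.lt_floor_add_one ((y - a) / ε)).le
    rw [div_le_iff₀ hε] at this
    simp only; linarith

/-- A cell has diameter at most `P / r`, so a grid of mesh `1 / r ≤ δ` needs `2 * P + 1` positions
in each horizontal direction and `⌈osc * r⌉ + 1` vertically. -/
theorem boxCount_le_sum_osc (hl : IsDigitIFS l u w r) (hr : 0 < r) (hK : IsCompact K)
    (hne : K.Nonempty) (hh : hutchinson l K = K) (hf : ContinuousOn f K) {P : ℕ}
    (hd : ∀ x ∈ K, ∀ y ∈ K, dist x y ≤ P) {δ : ℝ} (hrδ : (r : ℝ)⁻¹ ≤ δ) :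
    (boxCount δ (graphOver K f) : ℝ)
      ≤ (2 * P + 1) ^ 2 * (2 * Fintype.card ι + r * ∑ i, osc f (l i '' K)) := by
  have hr' : (0 : ℝ) < r := by exact_mod_cast hr
  have hmaps := mapsTo_of_hutchinson hh
  obtain ⟨x₀, hx₀⟩ := hne
  set ε : ℝ := (r : ℝ)⁻¹ with hε
  have hε0 : 0 < ε := inv_pos.2 hr'
  have hbdd : ∀ i, BddBelow (f '' (l i '' K)) ∧ BddAbove (f '' (l i '' K)) := fun i =>
    have hsub := image_mono (f := f) (hmaps i).image_subset
    ⟨(hK.image_of_continuousOn hf).bddBelow.mono hsub,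
      (hK.image_of_continuousOn hf).bddAbove.mono hsub⟩
  have hosc : ∀ i, 0 ≤ osc f (l i '' K) := fun i => osc_nonneg (hbdd i).1 (hbdd i).2
  let M : ι → ℕ := fun i => ⌈osc f (l i '' K) * r⌉₊
  let J := Σ i : ι, Fin (2 * P + 1) × Fin (2 * P + 1) × Fin (M i + 1)
  let c : J → EuclideanSpace ℝ (Fin 3) := fun j =>
    !₂[l j.1 x₀ 0 - P * ε + j.2.1 * ε, l j.1 x₀ 1 - P * ε + j.2.2.1 * ε,
      sInf (f '' (l j.1 '' K)) + j.2.2.2 * ε]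
  have hcov : graphOver K f ⊆ ⋃ j, box δ (c j) := by
    rintro _ ⟨y, hy, rfl⟩
    rw [← hh] at hy
    obtain ⟨i, x, hx, rfl⟩ := mem_iUnion.1 hy
    have hcoord : ∀ e : Fin 2, |l i x e - l i x₀ e| ≤ P * ε := fun e => by
      have h1 := PiLp.norm_apply_le (l i x - l i x₀) e
      rw [PiLp.sub_apply, Real.norm_eq_abs, ← dist_eq_norm, hl.dist_eq] at h1
      refine h1.trans ?_
      rw [mul_comm]
      exact mul_le_mul_of_nonneg_right (hd _ hx _ hx₀) hε0.le
    have hplane : ∀ e : Fin 2, ∃ j : Fin (2 * P + 1),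
        l i x₀ e - P * ε + j * ε ≤ l i x e ∧ l i x e ≤ l i x₀ e - P * ε + j * ε + δ := fun e => by
      have := abs_le.1 (hcoord e)
      exact exists_mem_subinterval hε0 hrδ (by linarith) (by push_cast; linarith)
    obtain ⟨j₀, h₀⟩ := hplane 0
    obtain ⟨j₁, h₁⟩ := hplane 1
    have hmem : f (l i x) ∈ f '' (l i '' K) := ⟨_, ⟨x, hx, rfl⟩, rfl⟩
    obtain ⟨j₂, h₂⟩ := exists_mem_subinterval (M := M i) hε0 hrδ (csInf_le (hbdd i).1 hmem) (by
      have h1 := le_csSup (hbdd i).2 hmem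
      have h2 : osc f (l i '' K) * r ≤ M i := Nat.le_ceil _
      have h3 : osc f (l i '' K) ≤ M i * ε := by
        rw [hε, ← div_eq_mul_inv, le_div_iff₀ hr']; exact h2
      unfold osc at h3
      linarith)
    exact mem_iUnion.2 ⟨⟨i, j₀, j₁, j₂⟩, mem_box_graph.2 ⟨h₀, h₁, h₂⟩⟩
  refine (Nat.cast_le.2 (boxCount_le_card c hcov)).trans ?_
  have hcard : (Fintype.card J : ℝ) = ∑ i, (2 * P + 1 : ℝ) ^ 2 * (M i + 1) := by
    simp only [J, Fintype.card_sigma, Fintype.card_prod, Fintype.card_fin]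
    push_cast
    exact Finset.sum_congr rfl fun i _ => by ring
  rw [hcard, ← Finset.mul_sum]
  refine mul_le_mul_of_nonneg_left ?_ (by positivity)
  have hM : ∀ i, (M i : ℝ) + 1 ≤ 2 + r * osc f (l i '' K) := fun i => by
    have := (Nat.ceil_lt_add_one (mul_nonneg (hosc i) hr'.le)).le
    simp only [M]; linarith
  refine (Finset.sum_le_sum fun i _ => hM i).trans_eq ?_
  rw [Finset.sum_add_distrib, ← Finset.mul_sum]
  simp [mul_comm]

end BoxCount

/-! ## Dimension estimates from box counts along a geometric sequence of scales -/

section Dimension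

variable {d : ℕ} {F : Set (EuclideanSpace ℝ (Fin d))} {r A c : ℝ}

theorem tendsto_log_one_div_atTop : Tendsto (fun δ : ℝ => Real.log (1 / δ)) (𝓝[>] 0) atTop := by
  simp only [one_div]
  exact Real.tendsto_log_atTop.comp tendsto_inv_nhdsGT_zero

theorem tendsto_coe_add_div_log (D C : ℝ) :
    Tendsto (fun δ : ℝ => ((D + C / Real.log (1 / δ) : ℝ) : EReal)) (𝓝[>] 0) (𝓝 (D : EReal)) := by
  refine (continuous_coe_real_ereal.tendsto D).comp ?_
  simpa using (tendsto_log_one_div_atTop.const_div_atTop C).const_add D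

theorem eventually_log_one_div_pos : ∀ᶠ δ : ℝ in 𝓝[>] 0, 0 < δ ∧ 0 < Real.log (1 / δ) :=
  (eventually_mem_nhdsWithin.mono fun _ h => h).and (tendsto_log_one_div_atTop.eventually_gt_atTop 0)

/-- Rounding `δ` to a scale `r ^ (-m)` changes the logarithm of the count by a bounded amount, which
disappears after division by `log (1 / δ)`. The absolute value of `log A` is needed as `A` may be
below 1. -/
theorem le_lowerBoxDim (hr : 1 < r) (hA : 0 < A) (hc : 0 < c)
    (h : ∀ (m : ℕ) (δ : ℝ), 0 < δ → r ^ m * δ ≤ 1 → c * A ^ m ≤ boxCount δ F) :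
    ((Real.log A / Real.log r : ℝ) : EReal) ≤ lowerBoxDim F := by
  have hlr : 0 < Real.log r := Real.log_pos hr
  rw [← (tendsto_coe_add_div_log (Real.log A / Real.log r)
    (Real.log c - |Real.log A|)).liminf_eq]
  refine liminf_le_liminf ?_
  filter_upwards [eventually_log_one_div_pos] with δ ⟨hδ, hl⟩
  rw [EReal.coe_le_coe_iff]
  set x := Real.log (1 / δ) with hx
  obtain ⟨m, hm⟩ : ∃ m, m = ⌊x / Real.log r⌋₊ := ⟨_, rfl⟩
  have h1 : m * Real.log r ≤ x := by
    have := Nat.floor_le (div_nonneg hl.le hlr.le)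
    rwa [← hm, le_div_iff₀ hlr] at this
  have h2 : x ≤ (m + 1) * Real.log r := by
    have := (Nat.lt_floor_add_one (x / Real.log r)).le
    rwa [← hm, div_le_iff₀ hlr] at this
  have hrm : r ^ m * δ ≤ 1 := by
    rw [← le_div_iff₀ hδ, ← Real.log_le_log_iff (by positivity) (by positivity), Real.log_pow]
    exact h1
  have hN := Real.log_le_log (by positivity) (h m δ hδ hrm)
  rw [Real.log_mul hc.ne' (by positivity), Real.log_pow] at hN
  have hmA : Real.log A / Real.log r * x - |Real.log A| ≤ m * Real.log A := by
    have e : x / Real.log r ≤ m + 1 := by rwa [div_le_iff₀ hlr]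
    have e' : m ≤ x / Real.log r := by rwa [le_div_iff₀ hlr]
    rw [div_mul_eq_mul_div, mul_div_assoc]
    rcases abs_cases (Real.log A) with ⟨ha, h0⟩ | ⟨ha, h0⟩ <;> rw [ha] <;> nlinarith
  rw [le_div_iff₀ hl, add_mul, div_mul_cancel₀ _ hl.ne']
  linarith

theorem upperBoxDim_le (hr : 1 < r) (hA : 1 ≤ A) (hc : 1 ≤ c)
    (h : ∀ (m : ℕ) (δ : ℝ), 0 < δ → 1 ≤ r ^ m * δ → boxCount δ F ≤ c * A ^ m) :
    upperBoxDim F ≤ ((Real.log A / Real.log r : ℝ) : EReal) := by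
  have hlr : 0 < Real.log r := Real.log_pos hr
  rw [← (tendsto_coe_add_div_log (Real.log A / Real.log r)
    (Real.log c + Real.log A)).limsup_eq]
  refine limsup_le_limsup ?_
  filter_upwards [eventually_log_one_div_pos] with δ ⟨hδ, hl⟩
  rw [EReal.coe_le_coe_iff]
  set x := Real.log (1 / δ) with hx
  obtain ⟨m, hm⟩ : ∃ m, m = ⌈x / Real.log r⌉₊ := ⟨_, rfl⟩
  have h1 : x ≤ m * Real.log r := by
    have := Nat.le_ceil (x / Real.log r)
    rwa [← hm, div_le_iff₀ hlr] at this
  have h2 : m ≤ x / Real.log r + 1 := by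
    have := (Nat.ceil_lt_add_one (div_nonneg hl.le hlr.le)).le
    rwa [← hm] at this
  have hrm : 1 ≤ r ^ m * δ := by
    rw [← div_le_iff₀ hδ, ← Real.log_le_log_iff (by positivity) (by positivity), Real.log_pow]
    exact h1
  have hlA := Real.log_nonneg hA
  have hlc := Real.log_nonneg hc
  have hN : Real.log (boxCount δ F) ≤ Real.log c + m * Real.log A := by
    rcases Nat.eq_zero_or_pos (boxCount δ F) with h0 | h0
    -- A zero count has logarithm 0 by convention; `1 ≤ A` and `1 ≤ c` cover this case.
    · rw [h0, Nat.cast_zero, Real.log_zero]; positivity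
    · have := Real.log_le_log (by exact_mod_cast h0) (h m δ hδ hrm)
      rwa [Real.log_mul (by positivity) (by positivity), Real.log_pow] at this
  have hmA : m * Real.log A ≤ Real.log A / Real.log r * x + Real.log A := by
    rw [div_mul_eq_mul_div, mul_div_assoc]
    nlinarith
  rw [div_le_iff₀ hl, add_mul, div_mul_cancel₀ _ hl.ne']
  linarith

theorem lowerBoxDim_le_upperBoxDim : lowerBoxDim F ≤ upperBoxDim F :=
  liminf_le_limsup

end Dimension

/-! ## Total oscillation -/

theorem abs_le_supNorm {X : Type*} [TopologicalSpace X] {K : Set X} (hK : IsCompact K) {g : X → ℝ}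
    (hg : ContinuousOn g K) {x : X} (hx : x ∈ K) : |g x| ≤ supNorm K g :=
  le_csSup (hK.image_of_continuousOn hg.abs).bddAbove (mem_image_of_mem _ hx)

theorem supNorm_nonneg {X : Type*} (K : Set X) (g : X → ℝ) : 0 ≤ supNorm K g :=
  Real.sSup_nonneg (by rintro _ ⟨x, -, rfl⟩; exact abs_nonneg _)

theorem supNorm_eq_abs {X : Type*} {K : Set X} (hK : K.Nonempty) {g : X → ℝ} {c : ℝ}
    (h : ∀ x ∈ K, g x = c) : supNorm K g = |c| := by
  unfold supNorm
  rw [image_congr (g := fun _ => |c|) fun x hx => by rw [h x hx], hK.image_const, csSup_singleton]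

theorem InOscSpace.exists_bound {ι X : Type*} [Fintype ι] [TopologicalSpace X] {l : ι → X → X}
    {K : Set X} {Λ η : ℝ} {g : X → ℝ} (hΛ : 0 < Λ) (h : InOscSpace l K Λ η g) :
    ∃ B, 0 ≤ B ∧ ∀ m, totalOsc l K m g ≤ B * (Λ ^ (Real.logb Λ (Fintype.card ι) - η)) ^ m := by
  obtain ⟨-, b, hb⟩ := h
  -- The defining supremum starts at `m = 1`, so level 0 is included by hand.
  refine ⟨max 0 (max b (totalOsc l K 0 g)), le_max_left _ _, fun m => ?_⟩
  rcases Nat.eq_zero_or_pos m with rfl | hm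
  · rw [pow_zero, mul_one]
    exact (le_max_right _ _).trans (le_max_right _ _)
  · have h1 := hb ⟨m, hm, rfl⟩
    rw [mul_comm (m : ℝ), Real.rpow_mul_natCast hΛ.le, div_le_iff₀ (by positivity)] at h1
    refine h1.trans (mul_le_mul_of_nonneg_right ?_ (by positivity))
    exact (le_max_left _ _).trans (le_max_right _ _)

theorem totalOsc_succ {ι X : Type*} [Fintype ι] (l : ι → X → X) (K : Set X) (m : ℕ) (g : X → ℝ) :
    totalOsc l K (m + 1) g
      = ∑ i, ∑ ω : Fin m → ι, osc g (l i '' (wordMap l ω '' K)) := by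
  unfold totalOsc
  rw [← (Fin.consEquiv fun _ : Fin (m + 1) => ι).sum_comp, Fintype.sum_prod_type]
  refine Finset.sum_congr rfl fun i _ => Finset.sum_congr rfl fun ω _ => ?_
  rw [image_image]
  rfl

/-- A linear recursive inequality with a geometric inhomogeneity has geometric growth. -/
theorem exists_le_mul_pow {a : ℕ → ℝ} {γ C ρ A : ℝ} (hγ : 0 ≤ γ) (hC : 0 ≤ C) (hρ : 0 ≤ ρ)
    (hA : γ < A) (hρA : ρ ≤ A) (h : ∀ m, a (m + 1) ≤ γ * a m + C * ρ ^ m) :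
    ∃ B, 0 ≤ B ∧ ∀ m, a m ≤ B * A ^ m := by
  -- With `C ≤ B * (A - γ)` the gap between `A` and `γ` absorbs the inhomogeneity; the strict
  -- inequality avoids resonance when `ρ = γ`.
  refine ⟨max (a 0) (C / (A - γ)), le_max_of_le_right (div_nonneg hC (sub_pos.2 hA).le), ?_⟩
  set B := max (a 0) (C / (A - γ))
  have hB : C ≤ B * (A - γ) := by
    rw [← div_le_iff₀ (sub_pos.2 hA)]; exact le_max_right _ _
  intro m
  induction m with
  | zero => simp [B]
  | succ m ih =>
    calc a (m + 1) ≤ γ * a m + C * ρ ^ m := h m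
      _ ≤ γ * (B * A ^ m) + B * (A - γ) * A ^ m := by
          have : 0 ≤ A ^ m := pow_nonneg (hγ.trans hA.le) m
          gcongr
      _ = B * A ^ (m + 1) := by ring

/-! ### Growth of the oscillation of a fractal interpolation function -/

section FIF

variable {ι : Type*} [Fintype ι] {l : ι → Plane → Plane} {K V₀ : Set Plane} {p : Plane → ℝ}
  {s q : ι → Plane → ℝ} {f : Plane → ℝ}

theorem osc_bdd {X : Type*} [TopologicalSpace X] {K S : Set X} (hK : IsCompact K) {g : X → ℝ}
    (hg : ContinuousOn g K) (hS : S ⊆ K) : BddBelow (g '' S) ∧ BddAbove (g '' S) :=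
  ⟨(hK.image_of_continuousOn hg).bddBelow.mono (image_mono hS),
    (hK.image_of_continuousOn hg).bddAbove.mono (image_mono hS)⟩

theorem IsFIF.totalOsc_succ_le (hf : IsFIF l K V₀ p s q f) (hK : IsCompact K) (hne : K.Nonempty)
    (hmaps : ∀ i, MapsTo (l i) K K) (m : ℕ) :
    totalOsc l K (m + 1) f ≤ gammaSup K s * totalOsc l K m f
      + ∑ i, (supNorm K f * totalOsc l K m (s i) + totalOsc l K m (q i)) := by
  rw [totalOsc_succ, gammaSup, Finset.sum_mul, ← Finset.sum_add_distrib]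
  refine Finset.sum_le_sum fun i _ => ?_
  unfold totalOsc
  rw [Finset.mul_sum, Finset.mul_sum, ← Finset.sum_add_distrib, ← Finset.sum_add_distrib]
  refine Finset.sum_le_sum fun ω _ => ?_
  have hS : wordMap l ω '' K ⊆ K := (mapsTo_wordMap hmaps ω).image_subset
  refine osc_le ((hne.image _).image _) ?_
  rintro _ ⟨x, hx, rfl⟩ _ ⟨y, hy, rfl⟩
  rw [hf.selfReferential i x (hS hx), hf.selfReferential i y (hS hy)]
  have bd := fun {g : Plane → ℝ} (hg : ContinuousOn g K) =>
    abs_sub_le_osc (osc_bdd hK hg hS).1 (osc_bdd hK hg hS).2 hx hy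
  -- The discrete product rule separates the oscillations of `f`, `s i` and `q i`.
  have e : s i x * f x + q i x - (s i y * f y + q i y)
      = s i x * (f x - f y) + (f y * (s i x - s i y) + (q i x - q i y)) := by ring
  rw [e]
  have h1 : s i x * (f x - f y) ≤ supNorm K (s i) * osc f (wordMap l ω '' K) := by
    refine (le_abs_self _).trans ?_
    rw [abs_mul]
    exact mul_le_mul (abs_le_supNorm hK (hf.continuousOn_s i) (hS hx)) (bd hf.continuousOn_f)
      (abs_nonneg _) (supNorm_nonneg _ _)
  have h2 : f y * (s i x - s i y) ≤ supNorm K f * osc (s i) (wordMap l ω '' K) := by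
    refine (le_abs_self _).trans ?_
    rw [abs_mul]
    exact mul_le_mul (abs_le_supNorm hK hf.continuousOn_f (hS hy)) (bd (hf.continuousOn_s i))
      (abs_nonneg _) (supNorm_nonneg _ _)
  have h3 := (le_abs_self _).trans (bd (hf.continuousOn_q i))
  linarith

theorem gammaSup_nonneg (K : Set Plane) (s : ι → Plane → ℝ) : 0 ≤ gammaSup K s :=
  Finset.sum_nonneg fun _ _ => supNorm_nonneg _ _

theorem IsFIF.exists_totalOsc_le (hf : IsFIF l K V₀ p s q f) (hK : IsCompact K) (hne : K.Nonempty)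
    (hmaps : ∀ i, MapsTo (l i) K K) {Λ η A : ℝ} (hΛ : 0 < Λ)
    (hs : ∀ i, InOscSpace l K Λ η (s i)) (hq : ∀ i, InOscSpace l K Λ η (q i))
    (hA : gammaSup K s < A) (hηA : Λ ^ (Real.logb Λ (Fintype.card ι) - η) ≤ A) :
    ∃ B, 0 ≤ B ∧ ∀ m, totalOsc l K m f ≤ B * A ^ m := by
  choose B hB0 hB using fun i => (hs i).exists_bound hΛ
  choose B' hB0' hB' using fun i => (hq i).exists_bound hΛ
  have hM := supNorm_nonneg K f
  refine exists_le_mul_pow (γ := gammaSup K s) (C := ∑ i, (supNorm K f * B i + B' i))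
    (gammaSup_nonneg K s)
    (Finset.sum_nonneg fun i _ => add_nonneg (mul_nonneg hM (hB0 i)) (hB0' i))
    (Real.rpow_nonneg hΛ.le _) hA hηA fun m => ?_
  refine (hf.totalOsc_succ_le hK hne hmaps m).trans (add_le_add le_rfl ?_)
  rw [Finset.sum_mul]
  refine Finset.sum_le_sum fun i _ => ?_
  rw [add_mul, mul_assoc]
  exact add_le_add (mul_le_mul_of_nonneg_left (hB i m) hM) (hB' i m)

/-- The deviation of `g` from linearity at the points `x₁`, `x₂`, `(1 - t) x₁ + t x₂` is
propagated to the cells. -/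
theorem mul_pow_le_totalOsc {X : Type*} [AddCommGroup X] [Module ℝ X] [TopologicalSpace X]
    {l : ι → X → X} {K : Set X} {f : X → ℝ} (hK : IsCompact K) (hf : ContinuousOn f K)
    (hmaps : ∀ i, MapsTo (l i) K K) {t : ℝ} (ht : t ∈ Ioo (0 : ℝ) 1)
    (hlin : ∀ i x y, l i ((1 - t) • x + t • y) = (1 - t) • l i x + t • l i y)
    {θ : ℝ → ℝ} (hθ : ∀ z, θ z ≤ |z|) {c : ι → ℝ} (hc : ∀ i, 0 ≤ c i)
    (hstep : ∀ i, c i ≠ 0 → ∀ x ∈ K, ∀ y ∈ K, (1 - t) • x + t • y ∈ K →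
      c i * θ (f ((1 - t) • x + t • y) - ((1 - t) * f x + t * f y))
        ≤ θ (f (l i ((1 - t) • x + t • y)) - ((1 - t) * f (l i x) + t * f (l i y))))
    {x y : X} (hx : x ∈ K) (hy : y ∈ K) (hxy : (1 - t) • x + t • y ∈ K) (m : ℕ) :
    θ (f ((1 - t) • x + t • y) - ((1 - t) * f x + t * f y)) * (∑ i, c i) ^ m
      ≤ totalOsc l K m f := by
  set z := (1 - t) • x + t • y with hz
  have hword : ∀ {m : ℕ} (ω : Fin m → ι),
      wordMap l ω z = (1 - t) • wordMap l ω x + t • wordMap l ω y := by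
    intro m ω
    induction m with
    | zero => rfl
    | succ m ih => rw [wordMap_succ, ih, hlin]; rfl
  -- Only letters of nonzero weight are controlled by `hstep`; words of zero weight need just `osc ≥
  -- 0`.
  have hD : ∀ {m : ℕ} (ω : Fin m → ι), ∏ j, c (ω j) ≠ 0 →
      θ (f z - ((1 - t) * f x + t * f y)) * ∏ j, c (ω j)
        ≤ θ (f (wordMap l ω z) - ((1 - t) * f (wordMap l ω x) + t * f (wordMap l ω y))) := by
    intro m ω
    induction m with
    | zero => simp [wordMap]
    | succ m ih =>
      intro h0
      rw [Fin.prod_univ_succ] at h0 ⊢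
      have h1 := ih (Fin.tail ω) (right_ne_zero_of_mul h0)
      have hm : ∀ v ∈ K, wordMap l (Fin.tail ω) v ∈ K := fun v hv => mapsTo_wordMap hmaps _ hv
      have h2 := hstep (ω 0) (left_ne_zero_of_mul h0) _ (hm x hx) _ (hm y hy)
        (by rw [← hword]; exact hm z hxy)
      rw [← hword] at h2
      refine le_trans ?_ h2
      calc _ = c (ω 0) * (θ (f z - ((1 - t) * f x + t * f y)) * ∏ j, c (Fin.tail ω j)) := by
            simp only [Fin.tail]; ring
        _ ≤ _ := mul_le_mul_of_nonneg_left h1 (hc _)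
  rw [Fintype.sum_pow, Finset.mul_sum]
  refine Finset.sum_le_sum fun ω _ => ?_
  obtain ⟨hb, ha⟩ := osc_bdd hK hf (mapsTo_wordMap hmaps ω).image_subset
  by_cases h0 : ∏ j, c (ω j) = 0
  · rw [h0, mul_zero]
    exact osc_nonneg hb ha
  -- The deviation is a convex combination of two differences of values of `f` on the cell.
  · refine (hD ω h0).trans ((hθ _).trans ?_)
    have h1 := abs_le.1 (abs_sub_le_osc hb ha ⟨z, hxy, rfl⟩ ⟨x, hx, rfl⟩)
    have h2 := abs_le.1 (abs_sub_le_osc hb ha ⟨z, hxy, rfl⟩ ⟨y, hy, rfl⟩)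
    rw [abs_le]
    constructor <;> nlinarith [ht.1, ht.2]

end FIF

/-! ## Box dimension of graphs over the gasket -/

section GasketGraph

variable {k : Fin 3 → Plane} {f : Plane → ℝ}

theorem exists_natCast_diam_bound (k : Fin 3 → Plane) :
    ∃ P : ℕ, ∀ x ∈ sierpinskiGasket k, ∀ y ∈ sierpinskiGasket k, dist x y ≤ P := by
  obtain ⟨d, hd⟩ := Metric.isBounded_iff.1 (isCompact_sierpinskiGasket k).isBounded
  obtain ⟨P, hP⟩ := exists_nat_ge d
  exact ⟨P, fun x hx y hy => (hd hx hy).trans hP⟩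

theorem exists_mul_le_boxCount (hk : IsEquilateral k) (n : ℕ)
    (hf : ContinuousOn f (sierpinskiGasket k)) :
    ∃ c : ℝ, 0 < c ∧ ∀ (m : ℕ) (δ : ℝ), 0 < δ → ((2 : ℝ) ^ n) ^ m * δ ≤ 1 →
      c * ((3 : ℝ) ^ n) ^ m ≤ boxCount δ (graphOver (sierpinskiGasket k) f) ∧
      c * (((2 : ℝ) ^ n) ^ m * totalOsc (sgWordMap k n) (sierpinskiGasket k) m f)
        ≤ boxCount δ (graphOver (sierpinskiGasket k) f) := by
  obtain ⟨P, hP⟩ := exists_natCast_diam_bound k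
  obtain ⟨Q, hQ⟩ := hk.exists_coord_bound (P + 2)
  have hK := isCompact_sierpinskiGasket k
  have hmaps := mapsTo_of_hutchinson (hutchinson_sgWordMap_sierpinskiGasket k n)
  refine ⟨((2 * Q + 1 : ℝ) ^ 2)⁻¹, by positivity, fun m δ hδ hmδ => ?_⟩
  have h := sum_max_osc_le_boxCount ((isDigitIFS_sgWordMap k n).wordMap (by positivity) m)
    (by positivity) hK (isConnected_sierpinskiGasket k) (mapsTo_wordMap hmaps) hf hP hQ hδ
    (by push_cast; exact hmδ)
  rw [inv_mul_le_iff₀ (by positivity), inv_mul_le_iff₀ (by positivity), mul_comm (_ ^ 2)]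
  constructor
  · refine le_trans ?_ h
    refine le_trans ?_ (Finset.sum_le_sum fun _ _ => le_max_left _ _)
    simp
  · refine le_trans ?_ h
    unfold totalOsc
    rw [Finset.mul_sum]
    refine Finset.sum_le_sum fun ω _ => le_trans ?_ (le_max_right _ _)
    obtain ⟨hb, ha⟩ := osc_bdd hK hf (mapsTo_wordMap hmaps ω).image_subset
    rw [le_div_iff₀ hδ]
    nlinarith [mul_le_mul_of_nonneg_left hmδ (osc_nonneg hb ha)]

theorem exists_boxCount_le (k : Fin 3 → Plane) (n : ℕ)
    (hf : ContinuousOn f (sierpinskiGasket k)) :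
    ∃ C : ℝ, 1 ≤ C ∧ ∀ (m : ℕ) (δ : ℝ), 0 < δ → 1 ≤ ((2 : ℝ) ^ n) ^ m * δ →
      boxCount δ (graphOver (sierpinskiGasket k) f)
        ≤ C * (((3 : ℝ) ^ n) ^ m
          + ((2 : ℝ) ^ n) ^ m * totalOsc (sgWordMap k n) (sierpinskiGasket k) m f) := by
  obtain ⟨P, hP⟩ := exists_natCast_diam_bound k
  have hK := isCompact_sierpinskiGasket k
  have hh := hutchinson_sgWordMap_sierpinskiGasket k n
  have hP1 : (1 : ℝ) ≤ (2 * P + 1) ^ 2 := one_le_pow₀ (by linarith [Nat.cast_nonneg (α := ℝ) P])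
  refine ⟨2 * (2 * P + 1) ^ 2, by linarith, fun m δ hδ hmδ => ?_⟩
  have h := boxCount_le_sum_osc ((isDigitIFS_sgWordMap k n).wordMap (by positivity) m)
    (by positivity) hK (nonempty_sierpinskiGasket k) (hutchinson_wordMap hh m) hf hP (δ := δ)
    (by push_cast; rwa [inv_le_iff_one_le_mul₀' (by positivity)])
  have hosc : 0 ≤ totalOsc (sgWordMap k n) (sierpinskiGasket k) m f :=
    Finset.sum_nonneg fun ω _ =>
      have hb := osc_bdd hK hf (mapsTo_wordMap (mapsTo_of_hutchinson hh) ω).image_subset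
      osc_nonneg hb.1 hb.2
  refine h.trans ?_
  rw [mul_comm (2 : ℝ) (_ ^ 2), mul_assoc]
  refine mul_le_mul_of_nonneg_left ?_ (by positivity)
  have hcard : (Fintype.card (Fin m → Fin n → Fin 3) : ℝ) = ((3 : ℝ) ^ n) ^ m := by simp
  rw [hcard]
  push_cast
  change 2 * ((3 : ℝ) ^ n) ^ m
    + ((2 : ℝ) ^ n) ^ m * totalOsc (sgWordMap k n) (sierpinskiGasket k) m f ≤ _
  have : 0 ≤ ((2 : ℝ) ^ n) ^ m * totalOsc (sgWordMap k n) (sierpinskiGasket k) m f := by positivity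
  linarith

theorem le_lowerBoxDim_graphOver (hk : IsEquilateral k) {n : ℕ} (hn : 1 ≤ n)
    (hf : ContinuousOn f (sierpinskiGasket k)) {ℓ γ : ℝ} (hℓ : 0 < ℓ) (hγ : 0 < γ)
    (h : ∀ m, ℓ * γ ^ m ≤ totalOsc (sgWordMap k n) (sierpinskiGasket k) m f) :
    ((1 + Real.logb (2 ^ n) γ : ℝ) : EReal) ≤ lowerBoxDim (graphOver (sierpinskiGasket k) f) := by
  obtain ⟨c, hc, hcN⟩ := exists_mul_le_boxCount hk n hf
  have hr : (1 : ℝ) < 2 ^ n := one_lt_pow₀ one_lt_two (by omega)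
  have e : 1 + Real.logb (2 ^ n) γ = Real.log (2 ^ n * γ) / Real.log (2 ^ n) := by
    rw [Real.log_mul (by positivity) hγ.ne', add_div, div_self (Real.log_pos hr).ne', Real.logb]
  rw [e]
  refine le_lowerBoxDim hr (by positivity) (mul_pos hc hℓ) fun m δ hδ hmδ => ?_
  refine le_trans ?_ (hcN m δ hδ hmδ).2
  rw [mul_pow, mul_assoc, mul_left_comm ℓ]
  have := h m
  gcongr

theorem log_three_div_log_two_le_lowerBoxDim (hk : IsEquilateral k)
    (hf : ContinuousOn f (sierpinskiGasket k)) :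
    ((Real.log 3 / Real.log 2 : ℝ) : EReal)
      ≤ lowerBoxDim (graphOver (sierpinskiGasket k) f) := by
  -- Only the number of cells matters here, so the three original maps suffice.
  obtain ⟨c, hc, hcN⟩ := exists_mul_le_boxCount hk 1 hf
  simp only [pow_one] at hcN
  exact le_lowerBoxDim one_lt_two (by norm_num) hc fun m δ hδ hmδ => (hcN m δ hδ hmδ).1

/-- The growth bound is assumed only for `A > A₀`; continuity of the logarithm reaches `A₀`. The
lower bound on `A₀` gives `3 ^ n ≤ 2 ^ n * A`, so the cell count is absorbed. -/
theorem upperBoxDim_graphOver_le {n : ℕ} (hn : 1 ≤ n)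
    (hf : ContinuousOn f (sierpinskiGasket k)) {A₀ : ℝ} (hA₀ : (3 / 2 : ℝ) ^ n ≤ A₀)
    (h : ∀ A, A₀ < A → ∃ B, 0 ≤ B ∧
      ∀ m, totalOsc (sgWordMap k n) (sierpinskiGasket k) m f ≤ B * A ^ m) :
    upperBoxDim (graphOver (sierpinskiGasket k) f)
      ≤ ((1 + Real.log A₀ / Real.log (2 ^ n) : ℝ) : EReal) := by
  obtain ⟨C, hC, hCN⟩ := exists_boxCount_le k n hf
  have hr : (1 : ℝ) < 2 ^ n := one_lt_pow₀ one_lt_two (by omega)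
  have hpos : 0 < A₀ := lt_of_lt_of_le (by positivity) hA₀
  have hlim : Tendsto (fun A => ((1 + Real.log A / Real.log (2 ^ n) : ℝ) : EReal)) (𝓝[>] A₀)
      (𝓝 ((1 + Real.log A₀ / Real.log (2 ^ n) : ℝ) : EReal)) := by
    refine (continuous_coe_real_ereal.tendsto _).comp ?_
    exact (((Real.continuousAt_log hpos.ne').tendsto.mono_left nhdsWithin_le_nhds).div_const
      _).const_add 1
  refine ge_of_tendsto hlim ?_
  filter_upwards [self_mem_nhdsWithin] with A hA
  have hA0 : 0 < A := hpos.trans hA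
  obtain ⟨B, hB, hAB⟩ := h A hA
  have e : 1 + Real.log A / Real.log (2 ^ n) = Real.log (2 ^ n * A) / Real.log (2 ^ n) := by
    rw [Real.log_mul (by positivity) hA0.ne', add_div, div_self (Real.log_pos hr).ne']
  rw [e]
  have h3 : (3 : ℝ) ^ n ≤ 2 ^ n * A := by
    have := mul_le_mul_of_nonneg_left (hA₀.trans (le_of_lt hA)) (by positivity : (0 : ℝ) ≤ 2 ^ n)
    rwa [div_pow, mul_div_cancel₀ _ (by positivity)] at this
  refine upperBoxDim_le (c := C * (1 + B)) hr ((one_le_pow₀ (by norm_num)).trans h3)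
    (one_le_mul_of_one_le_of_one_le hC (by linarith)) fun m δ hδ hmδ => ?_
  refine (hCN m δ hδ hmδ).trans ?_
  rw [mul_assoc]
  refine mul_le_mul_of_nonneg_left ?_ (by linarith)
  rw [add_mul, one_mul]
  refine add_le_add (pow_le_pow_left₀ (by positivity) h3 m) ?_
  rw [mul_pow, mul_left_comm B]
  exact mul_le_mul_of_nonneg_left (hAB m) (by positivity)

end GasketGraph

/-! ## Lower bounds for fractal interpolation functions -/

section Deviation

variable {k : Fin 3 → Plane} {n : ℕ} {p : Plane → ℝ} {s q : (Fin n → Fin 3) → Plane → ℝ}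
  {f : Plane → ℝ} {y₁ y₂ : Plane} {t : ℝ}

/-- If `θ` of the deviation from linearity is scaled by at least `c i` under each `l i` with
`c i ≠ 0`, then `∑ i, c i` gives a lower bound for the dimension of the graph. -/
theorem IsFIF.le_lowerBoxDim (hk : IsEquilateral k) (hn : 1 ≤ n)
    (hf : IsFIF (sgWordMap k n) (sierpinskiGasket k) (range k) p s q f)
    (hy₁ : y₁ ∈ sgVertices k n) (hy₂ : y₂ ∈ sgVertices k n)
    (hy₃ : (1 - t) • y₁ + t • y₂ ∈ sgVertices k n) (ht : t ∈ Ioo (0 : ℝ) 1)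
    {θ : ℝ → ℝ} (hθ : ∀ z, θ z ≤ |z|)
    (hL : 0 < θ (p ((1 - t) • y₁ + t • y₂) - ((1 - t) * p y₁ + t * p y₂)))
    {c : (Fin n → Fin 3) → ℝ} (hc : ∀ i, 0 ≤ c i) (hγ : ∑ i, c i ≠ 0)
    (hstep : ∀ i, c i ≠ 0 → ∃ σ, (∀ x ∈ sierpinskiGasket k, s i x = σ) ∧
      ∀ x ∈ sierpinskiGasket k, ∀ y ∈ sierpinskiGasket k,
        (1 - t) • x + t • y ∈ sierpinskiGasket k → ∀ D, c i * θ D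
          ≤ θ (σ * D + (q i ((1 - t) • x + t • y) - ((1 - t) * q i x + t * q i y)))) :
    ((1 + Real.logb (2 ^ n) (∑ i, c i) : ℝ) : EReal)
      ≤ lowerBoxDim (graphOver (sierpinskiGasket k) f) := by
  have hV := sgVertices_subset k n
  rw [← hf.interpolates _ hy₁, ← hf.interpolates _ hy₂, ← hf.interpolates _ hy₃] at hL
  refine le_lowerBoxDim_graphOver hk hn hf.continuousOn_f hL
    (lt_of_le_of_ne (Finset.sum_nonneg fun i _ => hc i) hγ.symm) fun m => ?_
  refine mul_pow_le_totalOsc (isCompact_sierpinskiGasket k) hf.continuousOn_f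
    (mapsTo_of_hutchinson (hutchinson_sgWordMap_sierpinskiGasket k n)) ht
    (fun i x y => (isDigitIFS_sgWordMap k n).lineMap_eq i t x y) hθ hc ?_ (hV hy₁) (hV hy₂)
    (hV hy₃) m
  intro i hi x hx y hy hxy
  obtain ⟨σ, hσ, hq⟩ := hstep i hi
  rw [hf.selfReferential i _ hx, hf.selfReferential i _ hy, hf.selfReferential i _ hxy, hσ _ hx,
    hσ _ hy, hσ _ hxy]
  refine (hq x hx y hy hxy _).trans_eq (congrArg θ ?_)
  ring

-- An affine `q i` adds no deviation, so its absolute value is multiplied exactly by `|σ|`; hence `θ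
-- = abs` and signs are irrelevant.
open Classical in
theorem IsFIF.gammaAffine_le_lowerBoxDim (hk : IsEquilateral k) (hn : 1 ≤ n)
    (hf : IsFIF (sgWordMap k n) (sierpinskiGasket k) (range k) p s q f)
    (hy₁ : y₁ ∈ sgVertices k n) (hy₂ : y₂ ∈ sgVertices k n)
    (hy₃ : (1 - t) • y₁ + t • y₂ ∈ sgVertices k n) (ht : t ∈ Ioo (0 : ℝ) 1)
    (hL : p ((1 - t) • y₁ + t • y₂) - ((1 - t) * p y₁ + t * p y₂) ≠ 0)
    (hγ : gammaAffine (sierpinskiGasket k) s q ≠ 0) :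
    ((1 + Real.logb (2 ^ n) (gammaAffine (sierpinskiGasket k) s q) : ℝ) : EReal)
      ≤ lowerBoxDim (graphOver (sierpinskiGasket k) f) := by
  refine hf.le_lowerBoxDim hk hn hy₁ hy₂ hy₃ ht (θ := abs) (fun z => le_rfl) (abs_pos.2 hL)
    (fun i => ?_) hγ fun i hi => ?_
  · split_ifs
    exacts [supNorm_nonneg _ _, le_rfl]
  · obtain ⟨⟨σ, hσ⟩, a, ha⟩ := (ite_ne_right_iff.1 hi).1
    refine ⟨σ, hσ, fun x hx y hy hxy D => ?_⟩
    have hlin : a ((1 - t) • x + t • y) = (1 - t) * a x + t * a y :=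
      Convex.combo_affine_apply (by ring)
    rw [if_pos (ite_ne_right_iff.1 hi).1, supNorm_eq_abs ⟨x, hx⟩ hσ, ha _ hx, ha _ hy, ha _ hxy,
      hlin, sub_self, add_zero, abs_mul]

-- A concave `q i` adds a non-negative deviation and `σ ≥ 0` preserves sign, so the signed deviation
-- (`θ = id`) is the quantity that grows.
open Classical in
theorem IsFIF.gammaConcave_le_lowerBoxDim (hk : IsEquilateral k) (hn : 1 ≤ n)
    (hf : IsFIF (sgWordMap k n) (sierpinskiGasket k) (range k) p s q f)
    (hy₁ : y₁ ∈ sgVertices k n) (hy₂ : y₂ ∈ sgVertices k n)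
    (hy₃ : (1 - t) • y₁ + t • y₂ ∈ sgVertices k n) (ht : t ∈ Ioo (0 : ℝ) 1)
    (hL : 0 < p ((1 - t) • y₁ + t • y₂) - ((1 - t) * p y₁ + t * p y₂))
    (hγ : gammaConcave (sierpinskiGasket k) s q ≠ 0) :
    ((1 + Real.logb (2 ^ n) (gammaConcave (sierpinskiGasket k) s q) : ℝ) : EReal)
      ≤ lowerBoxDim (graphOver (sierpinskiGasket k) f) := by
  refine hf.le_lowerBoxDim hk hn hy₁ hy₂ hy₃ ht (θ := id) le_abs_self hL
    (fun i => ?_) hγ fun i hi => ?_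
  · split_ifs
    exacts [supNorm_nonneg _ _, le_rfl]
  · obtain ⟨⟨σ, hσ0, hσ⟩, hq⟩ := (ite_ne_right_iff.1 hi).1
    refine ⟨σ, hσ, fun x hx y hy hxy D => ?_⟩
    have := hq x hx y hy t (Ioo_subset_Icc_self ht) hxy
    rw [if_pos (ite_ne_right_iff.1 hi).1, supNorm_eq_abs ⟨x, hx⟩ hσ, abs_of_nonneg hσ0]
    simp only [id]
    linarith

open Classical in
theorem IsFIF.gammaConvex_le_lowerBoxDim (hk : IsEquilateral k) (hn : 1 ≤ n)
    (hf : IsFIF (sgWordMap k n) (sierpinskiGasket k) (range k) p s q f)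
    (hy₁ : y₁ ∈ sgVertices k n) (hy₂ : y₂ ∈ sgVertices k n)
    (hy₃ : (1 - t) • y₁ + t • y₂ ∈ sgVertices k n) (ht : t ∈ Ioo (0 : ℝ) 1)
    (hL : p ((1 - t) • y₁ + t • y₂) - ((1 - t) * p y₁ + t * p y₂) < 0)
    (hγ : gammaConvex (sierpinskiGasket k) s q ≠ 0) :
    ((1 + Real.logb (2 ^ n) (gammaConvex (sierpinskiGasket k) s q) : ℝ) : EReal)
      ≤ lowerBoxDim (graphOver (sierpinskiGasket k) f) := by
  refine hf.le_lowerBoxDim hk hn hy₁ hy₂ hy₃ ht (θ := fun z => -z) neg_le_abs (neg_pos.2 hL)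
    (fun i => ?_) hγ fun i hi => ?_
  · split_ifs
    exacts [supNorm_nonneg _ _, le_rfl]
  · obtain ⟨⟨σ, hσ0, hσ⟩, hq⟩ := (ite_ne_right_iff.1 hi).1
    refine ⟨σ, hσ, fun x hx y hy hxy D => ?_⟩
    have := hq x hx y hy t (Ioo_subset_Icc_self ht) hxy
    rw [if_pos (ite_ne_right_iff.1 hi).1, supNorm_eq_abs ⟨x, hx⟩ hσ, abs_of_nonneg hσ0]
    linarith

/-- The growth rate of the total oscillation of functions in the oscillation space of exponent
`η`. -/
theorem rpow_logb_card_sub_le (n : ℕ) (hn : 1 ≤ n) (η : ℝ) :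
    ((2 : ℝ) ^ n) ^ (Real.logb (2 ^ n) (Fintype.card (Fin n → Fin 3)) - η)
      ≤ (3 / (2 : ℝ) ^ min 1 η) ^ n := by
  have hr : (1 : ℝ) < 2 ^ n := one_lt_pow₀ one_lt_two (by omega)
  rw [Real.rpow_sub (by positivity), Real.rpow_logb (by positivity) hr.ne' (by simp),
    div_pow, ← Real.rpow_mul_natCast (by norm_num), mul_comm, Real.rpow_mul (by norm_num),
    Real.rpow_natCast]
  simp only [Fintype.card_pi, Fintype.card_fin, Finset.prod_const, Finset.card_univ,
    Nat.cast_pow, Nat.cast_ofNat]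
  gcongr
  · exact hr.le
  · exact min_le_right _ _

end Deviation

end SGFIF

/-! ### The main theorem -/

open SGFIF
theorem mainTheorem3
    (k : Fin 3 → Plane) (hk : IsEquilateral k)
    (n : ℕ) (hn : 1 ≤ n)
    (p : Plane → ℝ) (s q : (Fin n → Fin 3) → Plane → ℝ) (f : Plane → ℝ)
    (hf : IsFIF (sgWordMap k n) (sierpinskiGasket k) (Set.range k) p s q f)
    (y₁ y₂ y₃ : Plane) (hy₁ : y₁ ∈ sgVertices k n) (hy₂ : y₂ ∈ sgVertices k n)
    (hy₃ : y₃ ∈ sgVertices k n)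
    (t : ℝ) (ht : t ∈ Set.Ioo (0 : ℝ) 1) (hy : y₃ = (1 - t) • y₁ + t • y₂)
    (L : ℝ) (hL : L = p y₃ - ((1 - t) * p y₁ + t * p y₂)) (hL0 : L ≠ 0) :
    (gammaAffine (sierpinskiGasket k) s q ≠ 0 →
      ((1 + Real.logb (2 ^ n) (gammaAffine (sierpinskiGasket k) s q) : ℝ) : EReal)
        ≤ lowerBoxDim (graphOver (sierpinskiGasket k) f)) ∧
    (0 < L → gammaConcave (sierpinskiGasket k) s q ≠ 0 →
      ((1 + Real.logb (2 ^ n) (gammaConcave (sierpinskiGasket k) s q) : ℝ) : EReal)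
        ≤ lowerBoxDim (graphOver (sierpinskiGasket k) f)) ∧
    (L < 0 → gammaConvex (sierpinskiGasket k) s q ≠ 0 →
      ((1 + Real.logb (2 ^ n) (gammaConvex (sierpinskiGasket k) s q) : ℝ) : EReal)
        ≤ lowerBoxDim (graphOver (sierpinskiGasket k) f)) ∧
    (∀ η ∈ Set.Icc (0 : ℝ) (Real.logb (2 ^ n) (3 ^ n)),
      (∀ i, InOscSpace (sgWordMap k n) (sierpinskiGasket k) (2 ^ n) η (s i)) →
      (∀ i, InOscSpace (sgWordMap k n) (sierpinskiGasket k) (2 ^ n) η (q i)) →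
      (gammaAffine (sierpinskiGasket k) s q = gammaSup (sierpinskiGasket k) s ∨
        (0 < L ∧ gammaConcave (sierpinskiGasket k) s q = gammaSup (sierpinskiGasket k) s) ∨
        (L < 0 ∧ gammaConvex (sierpinskiGasket k) s q = gammaSup (sierpinskiGasket k) s)) →
      ((3 / (2 : ℝ) ^ min 1 η) ^ n < gammaSup (sierpinskiGasket k) s →
        HasBoxDim (graphOver (sierpinskiGasket k) f)
          (1 + Real.log (gammaSup (sierpinskiGasket k) s) / Real.log (2 ^ n))) ∧
      (gammaSup (sierpinskiGasket k) s ≤ (3 / 2 : ℝ) ^ n → min 1 η = 1 →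
        HasBoxDim (graphOver (sierpinskiGasket k) f) (Real.log 3 / Real.log 2))) := by
  subst hy
  subst hL
  have affine := hf.gammaAffine_le_lowerBoxDim hk hn hy₁ hy₂ hy₃ ht hL0
  have concave := hf.gammaConcave_le_lowerBoxDim hk hn hy₁ hy₂ hy₃ ht
  have convex := hf.gammaConvex_le_lowerBoxDim hk hn hy₁ hy₂ hy₃ ht
  refine ⟨affine, concave, convex, fun η _ hs hq hγ => ?_⟩
  have hasDim : ∀ {d : ℝ}, (d : EReal) ≤ lowerBoxDim (graphOver (sierpinskiGasket k) f) →
      upperBoxDim (graphOver (sierpinskiGasket k) f) ≤ d →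
      HasBoxDim (graphOver (sierpinskiGasket k) f) d := fun h1 h2 =>
    ⟨le_antisymm (lowerBoxDim_le_upperBoxDim.trans h2) h1,
      le_antisymm h2 (h1.trans lowerBoxDim_le_upperBoxDim)⟩
  have hρ := rpow_logb_card_sub_le n hn η
  have upper : ∀ A₀, (3 / 2 : ℝ) ^ n ≤ A₀ → gammaSup (sierpinskiGasket k) s ≤ A₀ →
      (3 / (2 : ℝ) ^ min 1 η) ^ n ≤ A₀ → upperBoxDim (graphOver (sierpinskiGasket k) f)
        ≤ ((1 + Real.log A₀ / Real.log (2 ^ n) : ℝ) : EReal) := fun A₀ h1 h2 h3 =>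
    upperBoxDim_graphOver_le hn hf.continuousOn_f h1 fun A hA =>
      hf.exists_totalOsc_le (isCompact_sierpinskiGasket k) (nonempty_sierpinskiGasket k)
        (mapsTo_of_hutchinson (hutchinson_sgWordMap_sierpinskiGasket k n)) (by positivity) hs hq
        (h2.trans_lt hA) (hρ.trans (h3.trans hA.le))
  constructor
  · intro hlt
    -- Since `min 1 η ≤ 1`, `γ` dominates both competing rates and `A₀ = γ` is admissible.
    have h32 : (3 / 2 : ℝ) ^ n ≤ (3 / (2 : ℝ) ^ min 1 η) ^ n := by
      gcongr
      exact Real.rpow_le_self_of_one_le one_le_two (min_le_left _ _)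
    have hne : gammaSup (sierpinskiGasket k) s ≠ 0 :=
      (lt_of_le_of_lt (by positivity) hlt).ne'
    refine hasDim ?_ (upper _ (h32.trans hlt.le) le_rfl hlt.le)
    rcases hγ with h | ⟨h0, h⟩ | ⟨h0, h⟩ <;> rw [← h] at hne ⊢
    exacts [affine hne, concave h0 hne, convex h0 hne]
  · intro hle hη
    refine hasDim (log_three_div_log_two_le_lowerBoxDim hk hf.continuousOn_f) ?_
    -- At `A₀ = (3 / 2) ^ n` the oscillation term grows no faster than the cell count, up to an
    -- arbitrarily small loss in the exponent.
    have h := upper ((3 / 2 : ℝ) ^ n) le_rfl hle (by rw [hη, Real.rpow_one])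
    have hn' : (n : ℝ) ≠ 0 := by exact_mod_cast (by omega : n ≠ 0)
    have h2 : Real.log 2 ≠ 0 := (Real.log_pos one_lt_two).ne'
    have e : 1 + Real.log ((3 / 2 : ℝ) ^ n) / Real.log (2 ^ n) = Real.log 3 / Real.log 2 := by
      rw [Real.log_pow, Real.log_pow, Real.log_div (by norm_num) (by norm_num)]
      field_simp
      ring
    rwa [e] at h
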